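/- **Notation.** For a sample $(X_1,Y_1),\dots,(X_n,Y_n)$ of real pairs write $\widehat{\mu_X}=\frac1n\sum_i X_i$, and $$\widehat{\mu_X^m}=\frac{1}{n(n-1)\cdots(n-m+1)}\sum_{i_1,\dots,i_m\ \text{distinct}}X_{i_1}\cdots X_{i_m},\qquad \widehat{\mu_X\mu_Y}=\frac1{n(n-1)}\sum_{i\ne j}X_iY_j,$$ $$\widehat{\operatorname{Cov}(X,Y)}=\frac1{n-1}\sum_i(X_i-\widehat{\mu_X})(Y_i-\widehat{\mu_Y}),\qquad \widehat{\operatorname{Var}(X)}=\widehat{\operatorname{Cov}(X,X)},$$ $$\widehat{\operatorname{Cov}(X,Y)^2}=\frac{1}{n(n-1)(n-2)(n-3)}\sum_{i,j,k,l\ \text{distinct}}\frac{(X_i-X_j)(Y_i-Y_j)}{2}\cdot\frac{(X_k-X_l)(Y_k-Y_l)}{2},\qquad \widehat{\operatorname{Var}(X)^2}=\widehat{\operatorname{Cov}(X,X)^2},$$ and similarly with $Y$, $X^2$, $Y^2$ in place of $X$ or $Y$. A quotient with denominator $0$ is given the value $0$. Put $$r_a^*=\frac{\widehat{\operatorname{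Cov}(X,Y)}}{\widehat{\mu_X\mu_Y}}\Bigl(1+\tfrac1{n-1}\Bigl(\tfrac{\widehat{\mu_Y}\widehat{\operatorname{Cov}(X^2,Y)}+\widehat{\mu_X}\widehat{\operatorname{Cov}(Y^2,X)}}{\widehat{\operatorname{Cov}(X,Y)}\,\widehat{\mu_X}\,\widehat{\mu_Y}}-4\Bigr)-\tfrac1{n-1}\Bigl(\tfrac{\widehat{\operatorname{Var}(X)}}{\widehat{\mu_X^2}}+\tfrac{\widehat{\operatorname{Var}(Y)}}{\widehat{\mu_Y^2}}+2\tfrac{\widehat{\operatorname{Cov}(X,Y)}}{\widehat{\mu_X}\,\widehat{\mu_Y}}\Bigr)\Bigr),$$ $$r_b^*=\frac{\widehat{\operatorname{Var}(X)}}{\widehat{\mu_X^2}}\Bigl(1+\tfrac4{n-1}\Bigl(\tfrac{\frac12\widehat{\operatorname{Cov}(X^2,X)}}{\widehat{\mu_X}\widehat{\operatorname{Var}(X)}}-1\Bigr)-\tfrac4{n-1}\tfrac{\widehat{\operatorname{Var}(X)}}{\widehat{\mu_X^2}}\Bigr).$$ The corrected ratio of means is $$r^{(1)}_{corr}=\f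rac{\widehat{\mu_Y}}{\widehat{\mu_X}}\Bigl(1-\tfrac1n(r_b^*-r_a^*)-\tfrac1{n^2}\Bigl(\tfrac{\widehat{\operatorname{Cov}(X^2,Y)}-2\widehat{\mu_X}\widehat{\operatorname{Cov}(X,Y)}}{\widehat{\mu_X^2}\,\widehat{\mu_Y}}-\tfrac{\widehat{\operatorname{Cov}(X^2,X)}-2\widehat{\mu_X}\widehat{\operatorname{Var}(X)}}{\widehat{\mu_X^3}}-\tfrac{3\widehat{\operatorname{Var}(X)}\widehat{\operatorname{Cov}(X,Y)}}{\widehat{\mu_X^3}\,\widehat{\mu_Y}}+\tfrac{3\widehat{\operatorname{Var}(X)}^2}{\widehat{\mu_X^4}}\Bigr)\Bigr),$$ and the corrected ratio of second-order U-statistics is $$r^{(2)}_{corr}=\frac{\widehat{\mu_Y^2}}{\widehat{\mu_X^2}}\bigl(1+A-B-C+D+E-F\bigr),$$ where, with $Q_a=\widehat{\operatorname{Cov}(X,Y)^2}/(\widehat{\mu_X^2}\,\widehat{\mu_Y^2})$ and $Q_b=\widehat{\operatorname{Var}(X)^2}/\widehat{\mu_X^4}$, $$A=\tfrac{12}{n(n-1)}Q_a+\tfrac{24}n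 r_a^*,\qquad B=\tfrac{12}{n(n-1)}Q_b+\tfrac{24}n r_b^*,$$ $$C=\tfrac{32(n-2)}{n(n-1)^2}\Bigl(\tfrac{\widehat{\operatorname{Cov}(X^2,Y)}}{\widehat{\mu_X^2}\,\widehat{\mu_Y}}+\tfrac{2\widehat{\operatorname{Cov}(X,Y)}(\widehat{\operatorname{Var}(X)}+\widehat{\mu_X^2})}{\widehat{\mu_X^3}\,\widehat{\mu_Y}}\Bigr)+\tfrac{4(n-2)(n-3)}{n(n-1)}\Bigl(\tfrac8n r_a^*+\tfrac{12}{n(n-1)}Q_a\Bigr),$$ $$D=\tfrac{32(n-2)}{n(n-1)^2}\Bigl(\tfrac{\widehat{\operatorname{Cov}(X^2,X)}}{\widehat{\mu_X^3}}+\tfrac{2\widehat{\operatorname{Var}(X)}(\widehat{\operatorname{Var}(X)}+\widehat{\mu_X^2})}{\widehat{\mu_X^4}}\Bigr)+\tfrac{4(n-2)(n-3)}{n(n-1)}\Bigl(\tfrac8n r_b^*+\tfrac{12}{n(n-1)}Q_b\Bigr),$$ $$E=\tfrac{24(n-2)(n-3)(n-4)}{n^2(n-1)^3}\Bigl(\tfrac{\widehat{\operatorname{Cov}(X^2,Y)}}{\widehat{\mu_Y}\,\widehat{\mu_X^2}}+\tfrac{4\widehat{\operatorname{Cov}(X,Y)}(\widehat{\operatorname{Var}(X)}+\widehat{\mu_X^2})}{\widehat{\mu_Y}\,\widehat{\mu_X^3}}\Bigr)+\tfrac{(n-2)(n-3)(n-4)(n-5)}{n^2(n-1)^2}\Bigl(\tfrac{12}n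 r_a^*+\tfrac{30}{n(n-1)}Q_a\Bigr),$$ $$F=\tfrac{24(n-2)(n-3)(n-4)}{n^2(n-1)^3}\Bigl(\tfrac{\widehat{\operatorname{Cov}(X^2,X)}}{\widehat{\mu_X^3}}+\tfrac{4\widehat{\operatorname{Var}(X)}(\widehat{\operatorname{Var}(X)}+\widehat{\mu_X^2})}{\widehat{\mu_X^4}}\Bigr)+\tfrac{(n-2)(n-3)(n-4)(n-5)}{n^2(n-1)^2}\Bigl(\tfrac{12}n r_b^*+\tfrac{30}{n(n-1)}Q_b\Bigr).$$ **Proposition.** (1) Let $(X_i,Y_i)$ be i.i.d. pairs of real random variables with finite moments of all orders, and suppose that for some $a>0$ almost surely $X_1\ge a$ and ($Y_1=0$ or $Y_1\ge a$). Let $\mu_X=\mathbb E[X_1]$ and $\mu_Y=\mathbb E[Y_1]$. Then $r^{(1)}_{corr}$ and $r^{(2)}_{corr}$ are integrable for every $n$ and, as $n\to\infty$, $$\mathbb E\bigl[r^{(1)}_{corr}\bigr]-\frac{\mu_Y}{\mu_X}=O\Bigl(\frac1{n^2}\Bigr),\qquad \mathbb E\bigl[r^{(2)}_{corr}\bigr]-\frac{\mu_Y^2}{\mu_X^2}=O\Bigl(\frac1{n^2}\Bigr).$$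 (2) Let $f:\mathbb R^d\to\triangle^K=\{s\in[0,1]^K:\sum_k s_k=1\}$ be measurable, let $(x_i,y_i)$ be i.i.d. with values in $\mathbb R^d\times\{1,\dots,K\}$, let $h>0$ be a fixed bandwidth, $c\in\{1,\dots,K\}$ a class, and $z\in\triangle^K$ with $z_k>0$ for all $k$. Let $k(z;s)=\frac{\Gamma(\sum_k\alpha_k)}{\prod_k\Gamma(\alpha_k)}\prod_k z_k^{\alpha_k-1}$ with $\alpha_k=s_k/h+1$ be the Dirichlet kernel (the Beta kernel for $K=2$), and put $X_i=k(z;f(x_i))$ and $Y_i=k(z;f(x_i))\mathbf 1[y_i=c]$. Then the same conclusions hold, that is, both correction schemes reduce to $O(1/n^2)$ the bias of the ratio of means $\sum_iY_i/\sum_iX_i$ (the kernel estimator of the $c$-th coordinate of $\mathbb E[y\mid f(x)]$ at $f(x)=z$, for one-hot $y$) as an estimator of $\mu_Y/\mu_X$, and of the ratio of U-statistics $\bigl((\sum_iY_i)^2-\sum_iY_i^2\bigr)/\bigl((\sum_iX_i)^2-\sum_iX_i^2\bigr)$ (which occurs in the sharpness estimator) as an estimator of $\mu_Y^2/\mu_X^2$.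 -/

import Mathlib

open MeasureTheory ProbabilityTheory Filter Asymptotics

noncomputable section

namespace Debias

/-! Sample statistics: functions of a finite sample `x y : Fin n → ℝ`. As everywhere in Lean, a
quotient with denominator `0` has the value `0`. -/

/-- The U-statistic of order `m` with (not necessarily symmetric) kernel values `g e`: the average
of `g` over all `n (n-1) ⋯ (n-m+1)` ordered `m`-tuples `e` of pairwise distinct indices. -/
def uStat {n m : ℕ} (g : (Fin m → Fin n) → ℝ) : ℝ :=
  (∑ e : Fin m ↪ Fin n, g e) / (n.descFactorial m : ℝ)

/-- The sample mean, the unbiased estimator of `μ_X`. -/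
def meanHat {n : ℕ} (x : Fin n → ℝ) : ℝ := (∑ i, x i) / n

/-- The unbiased estimator of `μ_X ^ m`: the U-statistic with kernel `x₁ x₂ ⋯ x_m`. -/
def meanPowHat {n : ℕ} (m : ℕ) (x : Fin n → ℝ) : ℝ :=
  uStat fun e : Fin m → Fin n => ∏ k, x (e k)

/-- The unbiased estimator of `μ_X μ_Y`: the average of `X_i Y_j` over `i ≠ j`. -/
def meanProdHat {n : ℕ} (x y : Fin n → ℝ) : ℝ :=
  uStat fun e : Fin 2 → Fin n => x (e 0) * y (e 1)

/-- The unbiased sample covariance; `covHat x x` is the unbiased sample variance. -/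
def covHat {n : ℕ} (x y : Fin n → ℝ) : ℝ :=
  (∑ i, (x i - meanHat x) * (y i - meanHat y)) / ((n : ℝ) - 1)

/-- The unbiased estimator of `Cov(X, Y) ^ 2`, a U-statistic of order four. -/
def covSqHat {n : ℕ} (x y : Fin n → ℝ) : ℝ :=
  uStat fun e : Fin 4 → Fin n =>
    ((x (e 0) - x (e 1)) * (y (e 0) - y (e 1)) / 2) *
      ((x (e 2) - x (e 3)) * (y (e 2) - y (e 3)) / 2)

/-- The ratio of sample means. -/
def ratioMean {n : ℕ} (x y : Fin n → ℝ) : ℝ := meanHat y / meanHat x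

/-- The ratio of the second order U-statistics that estimate `μ_Y ^ 2` and `μ_X ^ 2`. -/
def ratioSq {n : ℕ} (x y : Fin n → ℝ) : ℝ := meanPowHat 2 y / meanPowHat 2 x

/-- `r_a^*`: the corrected version of `r_a`, the estimator of `Cov(X, Y) / (μ_X μ_Y)`. -/
def raStar {n : ℕ} (x y : Fin n → ℝ) : ℝ :=
  covHat x y / meanProdHat x y *
    (1 + 1 / ((n : ℝ) - 1) *
        ((meanHat y * covHat (fun i => x i ^ 2) y + meanHat x * covHat (fun i => y i ^ 2) x) /
          (covHat x y * meanHat x * meanHat y) - 4)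
      - 1 / ((n : ℝ) - 1) *
        (covHat x x / meanPowHat 2 x + covHat y y / meanPowHat 2 y +
          2 * (covHat x y / (meanHat x * meanHat y))))

/-- `r_b^*`: the corrected version of `r_b`, the estimator of `Var(X) / μ_X ^ 2`. -/
def rbStar {n : ℕ} (x : Fin n → ℝ) : ℝ :=
  covHat x x / meanPowHat 2 x *
    (1 + 4 / ((n : ℝ) - 1) *
        ((1 / 2) * covHat (fun i => x i ^ 2) x / (meanHat x * covHat x x) - 1)
      - 4 / ((n : ℝ) - 1) * (covHat x x / meanPowHat 2 x))

/-- The debiased ratio of means. -/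
def ratioMeanCorr {n : ℕ} (x y : Fin n → ℝ) : ℝ :=
  ratioMean x y *
    (1 - 1 / (n : ℝ) * (rbStar x - raStar x y)
      - 1 / (n : ℝ) ^ 2 *
        ((covHat (fun i => x i ^ 2) y - 2 * meanHat x * covHat x y) /
            (meanPowHat 2 x * meanHat y)
          - (covHat (fun i => x i ^ 2) x - 2 * meanHat x * covHat x x) / meanPowHat 3 x
          - 3 * covHat x x * covHat x y / (meanPowHat 3 x * meanHat y)
          + 3 * covHat x x ^ 2 / meanPowHat 4 x))

/-! The six correction terms for the ratio of squared means. -/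

/-- Estimator of `6 Cov(X̄₂, Ȳ₂) / (μ_X ^ 2 μ_Y ^ 2)`. -/
def termA {n : ℕ} (x y : Fin n → ℝ) : ℝ :=
  12 / ((n : ℝ) * (n - 1)) * (covSqHat x y / (meanPowHat 2 x * meanPowHat 2 y))
    + 24 / (n : ℝ) * raStar x y

/-- Estimator of `6 Var(X̄₂) / μ_X ^ 4`. -/
def termB {n : ℕ} (x : Fin n → ℝ) : ℝ :=
  12 / ((n : ℝ) * (n - 1)) * (covSqHat x x / meanPowHat 4 x)
    + 24 / (n : ℝ) * rbStar x

/-- Estimator of `4 Cov(X̄₂ ^ 2, Ȳ₂) / (μ_X ^ 4 μ_Y ^ 2)`. -/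
def termC {n : ℕ} (x y : Fin n → ℝ) : ℝ :=
  32 * ((n : ℝ) - 2) / ((n : ℝ) * ((n : ℝ) - 1) ^ 2) *
      (covHat (fun i => x i ^ 2) y / (meanPowHat 2 x * meanHat y)
        + 2 * covHat x y * (covHat x x + meanPowHat 2 x) / (meanPowHat 3 x * meanHat y))
    + 4 * ((n : ℝ) - 2) * ((n : ℝ) - 3) / ((n : ℝ) * ((n : ℝ) - 1)) *
      (8 / (n : ℝ) * raStar x y
        + 12 / ((n : ℝ) * (n - 1)) * (covSqHat x y / (meanPowHat 2 x * meanPowHat 2 y)))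

/-- Estimator of `4 Cov(X̄₂ ^ 2, X̄₂) / μ_X ^ 6`. -/
def termD {n : ℕ} (x : Fin n → ℝ) : ℝ :=
  32 * ((n : ℝ) - 2) / ((n : ℝ) * ((n : ℝ) - 1) ^ 2) *
      (covHat (fun i => x i ^ 2) x / meanPowHat 3 x
        + 2 * covHat x x * (covHat x x + meanPowHat 2 x) / meanPowHat 4 x)
    + 4 * ((n : ℝ) - 2) * ((n : ℝ) - 3) / ((n : ℝ) * ((n : ℝ) - 1)) *
      (8 / (n : ℝ) * rbStar x
        + 12 / ((n : ℝ) * (n - 1)) * (covSqHat x x / meanPowHat 4 x))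

/-- Estimator of `Cov(X̄₂ ^ 3, Ȳ₂) / (μ_X ^ 6 μ_Y ^ 2)`. -/
def termE {n : ℕ} (x y : Fin n → ℝ) : ℝ :=
  24 * ((n : ℝ) - 2) * ((n : ℝ) - 3) * ((n : ℝ) - 4) / ((n : ℝ) ^ 2 * ((n : ℝ) - 1) ^ 3) *
      (covHat (fun i => x i ^ 2) y / (meanHat y * meanPowHat 2 x)
        + 4 * covHat x y * (covHat x x + meanPowHat 2 x) / (meanHat y * meanPowHat 3 x))
    + ((n : ℝ) - 2) * ((n : ℝ) - 3) * ((n : ℝ) - 4) * ((n : ℝ) - 5) /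
        ((n : ℝ) ^ 2 * ((n : ℝ) - 1) ^ 2) *
      (12 / (n : ℝ) * raStar x y
        + 30 / ((n : ℝ) * (n - 1)) * (covSqHat x y / (meanPowHat 2 x * meanPowHat 2 y)))

/-- Estimator of `Cov(X̄₂ ^ 3, X̄₂) / μ_X ^ 8`. -/
def termF {n : ℕ} (x : Fin n → ℝ) : ℝ :=
  24 * ((n : ℝ) - 2) * ((n : ℝ) - 3) * ((n : ℝ) - 4) / ((n : ℝ) ^ 2 * ((n : ℝ) - 1) ^ 3) *
      (covHat (fun i => x i ^ 2) x / meanPowHat 3 x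
        + 4 * covHat x x * (covHat x x + meanPowHat 2 x) / meanPowHat 4 x)
    + ((n : ℝ) - 2) * ((n : ℝ) - 3) * ((n : ℝ) - 4) * ((n : ℝ) - 5) /
        ((n : ℝ) ^ 2 * ((n : ℝ) - 1) ^ 2) *
      (12 / (n : ℝ) * rbStar x
        + 30 / ((n : ℝ) * (n - 1)) * (covSqHat x x / meanPowHat 4 x))

/-- The debiased ratio of the U-statistics for the squared means. -/
def ratioSqCorr {n : ℕ} (x y : Fin n → ℝ) : ℝ :=
  ratioSq x y *
    (1 + termA x y - termB x - termC x y + termD x + termE x y - termF x)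

/-! Probability. -/

/-- The first `n` members of a sequence of random variables, at the outcome `ω`. -/
def sample {Ω : Type*} (X : ℕ → Ω → ℝ) (n : ℕ) (ω : Ω) : Fin n → ℝ := fun i => X i ω

/-- The random elements `Z 0, Z 1, …` are independent and identically distributed. -/
def IsIID {Ω S : Type*} [MeasurableSpace Ω] [MeasurableSpace S] (P : Measure Ω)
    (Z : ℕ → Ω → S) : Prop :=
  iIndepFun Z P ∧ ∀ i, IdentDistrib (Z i) (Z 0) P P

/-- The estimators `T n` of `R` have an expectation, and their bias is `O(1 / n ^ 2)`. -/
def HasBiasOrderTwo {Ω : Type*} [MeasurableSpace Ω] (P : Measure Ω)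
    (T : ℕ → Ω → ℝ) (R : ℝ) : Prop :=
  (∀ n, Integrable (T n) P) ∧
    (fun n : ℕ => (∫ ω, T n ω ∂P) - R) =O[atTop] fun n : ℕ => 1 / (n : ℝ) ^ 2

/-- The Dirichlet kernel with bandwidth `h`, centred at `s` and evaluated at `z`; for `K = 2` it
is the Beta kernel. -/
def dirichletKernel {K : ℕ} (h : ℝ) (z s : Fin K → ℝ) : ℝ :=
  Real.Gamma (∑ k, (s k / h + 1)) / (∏ k, Real.Gamma (s k / h + 1)) *
    ∏ k, z k ^ ((s k / h + 1) - 1)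

/-- The kernel weight `k(z; f(x_i))` of the `i`-th sample point at the evaluation point `z`. The
denominator of the kernel estimator of `E[y | f(x)]` at `z` is the sum of these weights. -/
def kernelWeight {Ω E : Type*} {K : ℕ} (k : (Fin K → ℝ) → (Fin K → ℝ) → ℝ) (z : Fin K → ℝ)
    (f : E → Fin K → ℝ) (x : ℕ → Ω → E) : ℕ → Ω → ℝ :=
  fun i ω => k z (f (x i ω))

/-- The kernel weight times the `c`-th coordinate of the one-hot encoding of the label. The
`c`-th coordinate of the numerator of the kernel estimator is the sum of these products. -/
def kernelLabel {Ω E : Type*} {K : ℕ} (k : (Fin K → ℝ) → (Fin K → ℝ) → ℝ) (z : Fin K → ℝ)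
    (f : E → Fin K → ℝ) (x : ℕ → Ω → E) (y : ℕ → Ω → Fin K) (c : Fin K) : ℕ → Ω → ℝ :=
  fun i ω => k z (f (x i ω)) * (if y i ω = c then 1 else 0)

end Debias

end

/-! Let `U`, `V` be the denominator and numerator statistics, estimating `m` and `m'`. Their errors
are O(n^(-1/2)) in every L^q, so a cubic Taylor expansion of 1/U at `m` leaves a remainder O(n^(-2))
in every L^q, provided 1/U has bounded moments. Centred third moments are O(n^(-2)), one half order
better than the L^q rate. With variance `s/n` and covariance `t/n` this gives E[V/U] = m'/m +
(m's/m³ - t/m²)/n + O(n^(-2)); this is `SecondOrder.meanBigO_ratio`.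

In both cases the 1/n coefficient is κ (m'/m)(c_b - c_a), where c_a = Cov(X,Y)/(μ_X μ_Y) and c_b =
Var(X)/μ_X², with κ = 1 for means and κ = 4 for the second-order U-statistics. The correcting factor
is 1 + (κ/n)(r_a* - r_b*) plus terms of order n^(-2) in L^q. Since V/U, r_a* and r_b* converge at
rate n^(-1/2) with bias O(1/n), a class closed under products (`Estimates.mul`), the expectation of
the correction cancels the leading bias up to O(n^(-2)): `SecondOrder.hasBiasOrderTwo`. At this
order only the combined 1/n coefficient matters; for the U-statistics it is 24 - 32 + 12 = 4
(`ratioSqCorr_eq`).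

The analytic difficulty is the denominators. Those built from X alone are bounded below whenever
they do not vanish. Those involving Y vanish or are at least b n^(-k); being small is a large
deviation, so high moments of the error pay for the factor n^k (`Estimates.lpBigO_inv`). A vanishing
denominator gives the value 0, and this event is negligible to any polynomial order
(`LpBigO.one_sub_mul_inv`). The sample covariance in the denominators of r_a* and r_b* has no lower
bound at all, but it cancels against the prefactor (`lpBigO_mul_inv_self`). If μ_Y = 0, then Y = 0
almost surely and the estimators vanish.

The Dirichlet kernel is continuous and positive on the compact simplex, hence lies between two
positive constants, and the second claim is a case of the first. -/

open scoped NNReal ENNReal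

namespace Debias

/-! ### Orders of magnitude in all L^q, orders of expectations, and their calculus. -/

section LpOrder

variable {Ω : Type*} [MeasurableSpace Ω] {P : Measure Ω}

/-- The random variable `f` has finite absolute moments of all orders. -/
def AllLp (P : Measure Ω) (f : Ω → ℝ) : Prop := ∀ q : ℕ, MemLp f q P

theorem const_isBigO_one_div_pow_zero (c : ℝ) :
    (fun _ : ℕ => c) =O[atTop] fun n : ℕ => 1 / (n : ℝ) ^ 0 := by
  simpa using isBigO_const_const (l := (atTop : Filter ℕ)) c (one_ne_zero (α := ℝ))

/-- Hölder's inequality at doubled exponents makes moments of all orders stable under products. The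
exponent q = 0 is included, so no side condition arises. -/
theorem holderTriple_two_mul (q : ℕ) :
    ENNReal.HolderTriple ((2 * q : ℕ) : ℝ≥0∞) ((2 * q : ℕ) : ℝ≥0∞) (q : ℝ≥0∞) := by
  constructor
  push_cast
  rw [ENNReal.mul_inv (by simp) (by simp), ← add_mul, ENNReal.inv_two_add_inv_two, one_mul]

namespace AllLp

variable {f g : Ω → ℝ}

theorem integrable (hf : AllLp P f) : Integrable f P := by
  simpa [memLp_one_iff_integrable] using hf 1

theorem aestronglyMeasurable (hf : AllLp P f) : AEStronglyMeasurable f P := (hf 0).1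

theorem add (hf : AllLp P f) (hg : AllLp P g) : AllLp P fun ω => f ω + g ω :=
  fun q => (hf q).add (hg q)

theorem sub (hf : AllLp P f) (hg : AllLp P g) : AllLp P fun ω => f ω - g ω :=
  fun q => (hf q).sub (hg q)

theorem mul (hf : AllLp P f) (hg : AllLp P g) : AllLp P fun ω => f ω * g ω := fun q =>
  have := holderTriple_two_mul q
  MemLp.mul' (hg (2 * q)) (hf (2 * q))

theorem const [IsFiniteMeasure P] (c : ℝ) : AllLp P fun _ => c := fun _ => memLp_const c

theorem pow [IsFiniteMeasure P] (hf : AllLp P f) (m : ℕ) : AllLp P fun ω => f ω ^ m := by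
  induction m with
  | zero => simpa using const 1
  | succ m ih => simpa [pow_succ] using ih.mul hf

theorem sum [IsFiniteMeasure P] {ι : Type*} (s : Finset ι) {f : ι → Ω → ℝ}
    (hf : ∀ i ∈ s, AllLp P (f i)) : AllLp P fun ω => ∑ i ∈ s, f i ω :=
  fun q => memLp_finsetSum s fun i hi => hf i hi q

theorem prod [IsFiniteMeasure P] {ι : Type*} (s : Finset ι) {f : ι → Ω → ℝ}
    (hf : ∀ i ∈ s, AllLp P (f i)) : AllLp P fun ω => ∏ i ∈ s, f i ω := by
  classical
  induction s using Finset.induction_on with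
  | empty => simpa using const 1
  | insert i s hi ih =>
    simp only [Finset.prod_insert hi]
    exact (hf i (by simp)).mul (ih fun j hj => hf j (by simp [hj]))

theorem of_le (hg : AllLp P g) (hf : AEStronglyMeasurable f P)
    (h : ∀ᵐ ω ∂P, |f ω| ≤ |g ω|) : AllLp P f :=
  fun q => (hg q).mono hf h

end AllLp

/-- The sequence `f` of random variables is `O(n ^ (-k / 2))` in every `L ^ q`. -/
structure LpBigO (P : Measure Ω) (k : ℕ) (f : ℕ → Ω → ℝ) : Prop where
  allLp : ∀ n, AllLp P (f n)
  bound : ∀ q : ℕ, ∃ C : ℝ≥0, ∀ᶠ n : ℕ in atTop,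
    eLpNorm (fun ω => √(n : ℝ) ^ k * f n ω) q P ≤ C

namespace LpBigO

variable {k l : ℕ} {f g : ℕ → Ω → ℝ}

theorem aestronglyMeasurable (hf : LpBigO P k f) (n : ℕ) : AEStronglyMeasurable (f n) P :=
  (hf.allLp n).aestronglyMeasurable

theorem add [IsProbabilityMeasure P] (hf : LpBigO P k f) (hg : LpBigO P k g) :
    LpBigO P k fun n ω => f n ω + g n ω := by
  refine ⟨fun n => (hf.allLp n).add (hg.allLp n), fun q => ?_⟩
  -- Minkowski needs an exponent at least 1; the shift to `q + 1` covers q = 0, and norms increase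
  -- with the exponent on a probability space.
  obtain ⟨C, hC⟩ := hf.bound (q + 1)
  obtain ⟨D, hD⟩ := hg.bound (q + 1)
  refine ⟨C + D, ?_⟩
  filter_upwards [hC, hD] with n hC hD
  have hmf := (hf.aestronglyMeasurable n).const_mul (√(n : ℝ) ^ k)
  have hmg := (hg.aestronglyMeasurable n).const_mul (√(n : ℝ) ^ k)
  simp only [mul_add]
  calc eLpNorm (fun ω => √(n : ℝ) ^ k * f n ω + √(n : ℝ) ^ k * g n ω) q P
      ≤ eLpNorm (fun ω => √(n : ℝ) ^ k * f n ω + √(n : ℝ) ^ k * g n ω) (q + 1 : ℕ) P :=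
        eLpNorm_le_eLpNorm_of_exponent_le (by simp) (hmf.add hmg)
    _ ≤ _ := eLpNorm_add_le hmf hmg (by simp)
    _ ≤ _ := by push_cast at hC hD ⊢; exact add_le_add hC hD

theorem mul (hf : LpBigO P k f) (hg : LpBigO P l g) :
    LpBigO P (k + l) fun n ω => f n ω * g n ω := by
  refine ⟨fun n => (hf.allLp n).mul (hg.allLp n), fun q => ?_⟩
  obtain ⟨C, hC⟩ := hf.bound (2 * q)
  obtain ⟨D, hD⟩ := hg.bound (2 * q)
  refine ⟨C * D, ?_⟩
  filter_upwards [hC, hD] with n hC hD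
  have := holderTriple_two_mul q
  have := eLpNorm_smul_le_mul_eLpNorm (p := (2 * q : ℕ)) (q := (2 * q : ℕ)) (r := q)
    ((hg.aestronglyMeasurable n).const_mul (√(n : ℝ) ^ l))
    ((hf.aestronglyMeasurable n).const_mul (√(n : ℝ) ^ k))
  refine le_trans (le_of_eq ?_) (this.trans ?_)
  · congr 1
    ext ω
    simp only [Pi.smul_apply', smul_eq_mul]
    ring
  · push_cast at hC hD ⊢
    exact mul_le_mul' hC hD

theorem const_det [IsProbabilityMeasure P] {d : ℕ → ℝ} {j : ℕ}
    (hd : d =O[atTop] fun n : ℕ => 1 / (n : ℝ) ^ j) : LpBigO P (2 * j) fun n _ => d n := by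
  refine ⟨fun n => AllLp.const _, fun q => ?_⟩
  obtain ⟨C, hC⟩ := hd.bound
  refine ⟨C.toNNReal, ?_⟩
  filter_upwards [hC, eventually_gt_atTop 0] with n hC hn
  have hn' : (0 : ℝ) < n := by exact_mod_cast hn
  refine (eLpNorm_le_of_ae_bound (C := C) (Eventually.of_forall fun ω => ?_)).trans ?_
  · rw [pow_mul, Real.sq_sqrt hn'.le, norm_mul, norm_pow, Real.norm_natCast]
    calc (n : ℝ) ^ j * ‖d n‖ ≤ n ^ j * (C * ‖1 / (n : ℝ) ^ j‖) := by gcongr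
      _ = C := by
        rw [norm_div, norm_one, norm_pow, Real.norm_natCast]
        field_simp
  · simp [ENNReal.ofReal]

theorem const [IsProbabilityMeasure P] (c : ℝ) : LpBigO P 0 fun _ _ => c :=
  const_det (j := 0) (const_isBigO_one_div_pow_zero c)

theorem const_mul [IsProbabilityMeasure P] (c : ℝ) (hf : LpBigO P k f) :
    LpBigO P k fun n ω => c * f n ω := by
  simpa using (const c).mul hf

theorem neg [IsProbabilityMeasure P] (hf : LpBigO P k f) : LpBigO P k fun n ω => -f n ω := by
  simpa using hf.const_mul (-1)

theorem sub [IsProbabilityMeasure P] (hf : LpBigO P k f) (hg : LpBigO P k g) :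
    LpBigO P k fun n ω => f n ω - g n ω := by
  simpa [sub_eq_add_neg] using hf.add hg.neg

theorem pow [IsProbabilityMeasure P] (hf : LpBigO P k f) (m : ℕ) :
    LpBigO P (k * m) fun n ω => f n ω ^ m := by
  induction m with
  | zero => simpa using const 1
  | succ m ih => simpa [pow_succ, mul_add] using ih.mul hf

theorem of_eventually_le (hg : LpBigO P k g) (hf : ∀ n, AllLp P (f n))
    (h : ∀ᶠ n in atTop, ∀ᵐ ω ∂P, |f n ω| ≤ |g n ω|) : LpBigO P k f := by
  refine ⟨hf, fun q => ?_⟩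
  obtain ⟨C, hC⟩ := hg.bound q
  refine ⟨C, ?_⟩
  filter_upwards [hC, h] with n hC h
  refine (eLpNorm_mono_ae ?_).trans hC
  filter_upwards [h] with ω hω
  rw [norm_mul, norm_mul]
  exact mul_le_mul_of_nonneg_left hω (norm_nonneg _)

theorem of_le (hg : LpBigO P k g) (hf : ∀ n, AEStronglyMeasurable (f n) P)
    (h : ∀ n, ∀ᵐ ω ∂P, |f n ω| ≤ |g n ω|) : LpBigO P k f :=
  hg.of_eventually_le (fun n => (hg.allLp n).of_le (hf n) (h n)) (Eventually.of_forall h)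

theorem congr (hg : LpBigO P k g) (hf : ∀ n, AllLp P (f n))
    (h : ∀ᶠ n in atTop, f n =ᵐ[P] g n) : LpBigO P k f :=
  hg.of_eventually_le hf (h.mono fun _ hn => hn.mono fun _ hω => (congrArg abs hω).le)

theorem mono (hf : LpBigO P l f) (hkl : k ≤ l) : LpBigO P k f := by
  refine ⟨hf.allLp, fun q => ?_⟩
  obtain ⟨C, hC⟩ := hf.bound q
  refine ⟨C, ?_⟩
  filter_upwards [hC, eventually_gt_atTop 0] with n hC hn
  refine (eLpNorm_mono_ae (Eventually.of_forall fun ω => ?_)).trans hC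
  rw [norm_mul, norm_mul]
  refine mul_le_mul_of_nonneg_right ?_ (norm_nonneg _)
  rw [norm_pow, norm_pow]
  refine pow_le_pow_right₀ ?_ hkl
  rw [Real.norm_of_nonneg (Real.sqrt_nonneg _), Real.one_le_sqrt]
  exact_mod_cast hn

theorem integral_isBigO {j : ℕ} (hf : LpBigO P (2 * j) f) :
    (fun n => ∫ ω, f n ω ∂P) =O[atTop] fun n : ℕ => 1 / (n : ℝ) ^ j := by
  obtain ⟨C, hC⟩ := hf.bound 1
  refine IsBigO.of_bound C ?_
  filter_upwards [hC, eventually_gt_atTop 0] with n hC hn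
  have hn' : (0 : ℝ) < n := by exact_mod_cast hn
  rw [Nat.cast_one, eLpNorm_one_eq_lintegral_enorm] at hC
  have h1 := (enorm_integral_le_lintegral_enorm fun ω => √(n : ℝ) ^ (2 * j) * f n ω).trans hC
  rw [integral_const_mul, pow_mul, Real.sq_sqrt hn'.le] at h1
  have h2 : ‖(n : ℝ) ^ j * ∫ ω, f n ω ∂P‖ ≤ C := by
    rw [← ofReal_norm] at h1
    simpa using ENNReal.toReal_mono ENNReal.coe_ne_top h1
  rw [norm_mul, norm_pow, Real.norm_natCast] at h2
  rw [norm_div, norm_one, norm_pow, Real.norm_natCast, mul_one_div, le_div_iff₀ (by positivity)]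
  linarith

end LpBigO

/-- The random variables `f n` have all moments, and their expectations are `O(1 / n ^ j)`. -/
structure MeanBigO (P : Measure Ω) (j : ℕ) (f : ℕ → Ω → ℝ) : Prop where
  allLp : ∀ n, AllLp P (f n)
  isBigO : (fun n => ∫ ω, f n ω ∂P) =O[atTop] fun n : ℕ => 1 / (n : ℝ) ^ j

namespace MeanBigO

variable {j i : ℕ} {f g : ℕ → Ω → ℝ}

theorem of_lpBigO (hf : LpBigO P (2 * j) f) : MeanBigO P j f := ⟨hf.allLp, hf.integral_isBigO⟩

theorem add (hf : MeanBigO P j f) (hg : MeanBigO P j g) :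
    MeanBigO P j fun n ω => f n ω + g n ω := by
  refine ⟨fun n => (hf.allLp n).add (hg.allLp n), ?_⟩
  simp only [integral_add (hf.allLp _).integrable (hg.allLp _).integrable]
  exact hf.isBigO.add hg.isBigO

/-- Only deterministic factors are allowed: a small expectation says nothing about the product with
another random variable. -/
theorem det_mul [IsProbabilityMeasure P] {d : ℕ → ℝ}
    (hd : d =O[atTop] fun n : ℕ => 1 / (n : ℝ) ^ i) (hf : MeanBigO P j f) :
    MeanBigO P (i + j) fun n ω => d n * f n ω := by
  refine ⟨fun n => (AllLp.const _).mul (hf.allLp n), ?_⟩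
  simp only [integral_const_mul]
  refine (hd.mul hf.isBigO).congr_right fun n => ?_
  rw [pow_add, one_div_mul_one_div]

theorem const_mul [IsProbabilityMeasure P] (c : ℝ) (hf : MeanBigO P j f) :
    MeanBigO P j fun n ω => c * f n ω := by
  simpa using hf.det_mul (i := 0) (d := fun _ => c)
    (const_isBigO_one_div_pow_zero c)

theorem sub [IsProbabilityMeasure P] (hf : MeanBigO P j f) (hg : MeanBigO P j g) :
    MeanBigO P j fun n ω => f n ω - g n ω := by
  simpa [sub_eq_add_neg] using hf.add (hg.const_mul (-1))

theorem congr (hg : MeanBigO P j g) (hf : ∀ n, AllLp P (f n))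
    (h : ∀ᶠ n in atTop, f n =ᵐ[P] g n) : MeanBigO P j f :=
  ⟨hf, hg.isBigO.congr' (h.mono fun _ hn => (integral_congr_ae hn).symm) EventuallyEq.rfl⟩

theorem mono (hf : MeanBigO P j f) (h : i ≤ j) : MeanBigO P i f := by
  refine ⟨hf.allLp, hf.isBigO.trans (IsBigO.of_bound 1 ?_)⟩
  filter_upwards [eventually_gt_atTop 0] with n hn
  have hn' : (1 : ℝ) ≤ n := by exact_mod_cast hn
  rw [one_mul, norm_div, norm_div, norm_one, norm_pow, norm_pow, Real.norm_natCast]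
  gcongr

end MeanBigO

/-- The estimators `f n` converge to the constant `c` at rate `n ^ (-1/2)` in every `L ^ q`, with
bias `O(1 / n)`. -/
structure Estimates (P : Measure Ω) (f : ℕ → Ω → ℝ) (c : ℝ) : Prop where
  lpBigO : LpBigO P 1 fun n ω => f n ω - c
  bias : MeanBigO P 1 fun n ω => f n ω - c

namespace Estimates

variable {f g : ℕ → Ω → ℝ} {c d : ℝ}

theorem of_sub_lpBigO (h : LpBigO P 2 fun n ω => f n ω - c) : Estimates P f c :=
  ⟨h.mono (by norm_num), .of_lpBigO h⟩

variable [IsProbabilityMeasure P]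

theorem const (c : ℝ) : Estimates P (fun _ _ => c) c :=
  of_sub_lpBigO <| by
    simpa using LpBigO.const_det (P := P) (d := fun _ => 0) (j := 1) (isBigO_zero _ _)

theorem lpBigO_zero (hf : Estimates P f c) : LpBigO P 0 f := by
  simpa using (hf.lpBigO.mono zero_le_one).add (LpBigO.const c)

theorem allLp (hf : Estimates P f c) (n : ℕ) : AllLp P (f n) := hf.lpBigO_zero.allLp n

theorem congr (hg : Estimates P g c) (hf : ∀ n, AllLp P (f n))
    (h : ∀ᶠ n in atTop, f n =ᵐ[P] g n) : Estimates P f c :=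
  ⟨hg.lpBigO.congr (fun n => (hf n).sub (AllLp.const c))
      (h.mono fun n hn => by filter_upwards [hn] with ω hω; rw [hω]),
    hg.bias.congr (fun n => (hf n).sub (AllLp.const c))
      (h.mono fun n hn => by filter_upwards [hn] with ω hω; rw [hω])⟩

theorem add (hf : Estimates P f c) (hg : Estimates P g d) :
    Estimates P (fun n ω => f n ω + g n ω) (c + d) := by
  constructor
  · convert hf.lpBigO.add hg.lpBigO using 3; ring
  · convert hf.bias.add hg.bias using 3; ring

theorem const_mul (a : ℝ) (hf : Estimates P f c) :
    Estimates P (fun n ω => a * f n ω) (a * c) := by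
  constructor
  · convert hf.lpBigO.const_mul a using 3; ring
  · convert hf.bias.const_mul a using 3; ring

theorem sub (hf : Estimates P f c) (hg : Estimates P g d) :
    Estimates P (fun n ω => f n ω - g n ω) (c - d) := by
  have := hf.add (hg.const_mul (-1))
  simpa [sub_eq_add_neg] using this

/-- fg - cd = (f - c)(g - d) + c(g - d) + d(f - c), and the product of the two errors is already
O(1/n) in every L^q, so it affects neither rate nor bias. -/
theorem mul (hf : Estimates P f c) (hg : Estimates P g d) :
    Estimates P (fun n ω => f n ω * g n ω) (c * d) := by
  have h2 := hf.lpBigO.mul hg.lpBigO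
  constructor
  · convert ((h2.mono (Nat.le_succ 1)).add (hg.lpBigO.const_mul c)).add
      (hf.lpBigO.const_mul d) using 3
    ring
  · convert ((MeanBigO.of_lpBigO (j := 1) h2).add (hg.bias.const_mul c)).add
      (hf.bias.const_mul d) using 3
    ring

/-- Used to discard every finite-sample correction that carries a factor 1/(n - 1). -/
theorem add_lpBigO (hf : Estimates P f c) (hg : LpBigO P 2 g) :
    Estimates P (fun n ω => f n ω + g n ω) c := by
  simpa using hf.add (of_sub_lpBigO (c := 0) (by simpa using hg))

end Estimates

/-! ### Inverses of estimators, including denominators that may vanish. -/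

/-- `g n` vanishes or is at least `b * n ^ (-k)` in absolute value, almost surely. -/
def ZeroOrLarge (P : Measure Ω) (k : ℕ) (b : ℝ) (g : ℕ → Ω → ℝ) : Prop :=
  ∀ n, ∀ᵐ ω ∂P, g n ω = 0 ∨ b ≤ (n : ℝ) ^ k * |g n ω|

variable {f g : ℕ → Ω → ℝ} {m b : ℝ} {k : ℕ}

theorem ZeroOrLarge.abs_inv_le (hg : ZeroOrLarge P k b g) (hb : 0 < b) (n : ℕ) :
    ∀ᵐ ω ∂P, |(g n ω)⁻¹| ≤ (n : ℝ) ^ k / b := by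
  filter_upwards [hg n] with ω hω
  rcases hω with h | h
  · rw [h]; simp; positivity
  · have hpos : 0 < |g n ω| := by
      by_contra h0
      have : |g n ω| = 0 := le_antisymm (not_lt.1 h0) (abs_nonneg _)
      rw [this, mul_zero] at h
      linarith
    rw [abs_inv, inv_eq_one_div, div_le_div_iff₀ hpos hb]
    linarith

theorem LpBigO.inv_of_large [IsProbabilityMeasure P] (hg : ZeroOrLarge P 0 b g) (hb : 0 < b)
    (hm : ∀ n, AEStronglyMeasurable (g n) P) : LpBigO P 0 fun n ω => (g n ω)⁻¹ := by
  refine (LpBigO.const (1 / b)).of_le (fun n => (hm n).aemeasurable.inv.aestronglyMeasurable)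
    fun n => ?_
  filter_upwards [hg.abs_inv_le hb n] with ω hω
  rw [abs_of_pos (by positivity : 0 < 1 / b)]
  simpa using hω

/-- An estimator of a nonzero constant that is not too small unless it vanishes has bounded
inverse moments. -/
theorem Estimates.lpBigO_inv [IsProbabilityMeasure P] (hg : Estimates P g m) (hm : m ≠ 0)
    (hl : ZeroOrLarge P k b g) (hb : 0 < b) : LpBigO P 0 fun n ω => (g n ω)⁻¹ := by
  have hm' : 0 < |m| := abs_pos.2 hm
  -- Where |g| ≥ |m|/2 the inverse is at most 2/|m|. Elsewhere it is at most n^k/b, while 2|g -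
  -- m|/|m| ≥ 1; the power `2 * k` of this ratio is of order n^(-k) in every L^q and absorbs n^k.
  have h1 := (hg.lpBigO.pow (2 * k)).const_mul ((2 / |m|) ^ (2 * k) / b)
  have h2 : LpBigO P 0 fun n ω =>
      (n : ℝ) ^ k * ((2 / |m|) ^ (2 * k) / b * (g n ω - m) ^ (2 * k)) := by
    refine ⟨fun n => (AllLp.const _).mul (h1.allLp n), fun q => ?_⟩
    obtain ⟨C, hC⟩ := h1.bound q
    refine ⟨C, hC.mono fun n hn => ?_⟩
    rw [one_mul, pow_mul, Real.sq_sqrt (Nat.cast_nonneg n)] at hn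
    simpa using hn
  refine ((LpBigO.const (2 / |m|)).add h2).of_le
    (fun n => (hg.allLp n).aestronglyMeasurable.aemeasurable.inv.aestronglyMeasurable)
    fun n => ?_
  filter_upwards [hl.abs_inv_le hb n] with ω hω
  refine le_trans ?_ (le_abs_self _)
  have hpow : (g n ω - m) ^ (2 * k) = |g n ω - m| ^ (2 * k) := by
    rw [pow_mul, pow_mul, sq_abs]
  rw [hpow]
  by_cases hc : |m| / 2 ≤ |g n ω|
  · have : |(g n ω)⁻¹| ≤ 2 / |m| := by
      rw [abs_inv, ← inv_div]
      exact inv_anti₀ (by positivity) hc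
    refine this.trans (le_add_of_nonneg_right ?_)
    positivity
  · have h3 : |m| / 2 ≤ |g n ω - m| := by
      have := abs_sub_abs_le_abs_sub m (g n ω)
      rw [abs_sub_comm] at this
      linarith
    have h4 : 1 ≤ 2 / |m| * |g n ω - m| := by
      rw [div_mul_eq_mul_div, le_div_iff₀ hm']
      linarith
    calc |(g n ω)⁻¹| ≤ (n : ℝ) ^ k / b := hω
      _ = (n : ℝ) ^ k / b * 1 := (mul_one _).symm
      _ ≤ (n : ℝ) ^ k / b * (2 / |m| * |g n ω - m|) ^ (2 * k) := by
        gcongr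
        exact one_le_pow₀ h4
      _ = (n : ℝ) ^ k * ((2 / |m|) ^ (2 * k) / b * |g n ω - m| ^ (2 * k)) := by
        rw [mul_pow]; ring
      _ ≤ _ := le_add_of_nonneg_left (by positivity)

/-- The expression is the indicator of g = 0, and there |(g - m)/m|^r equals 1. Hence it is
dominated by a power of the error, with `r` at will. -/
theorem LpBigO.one_sub_mul_inv [IsProbabilityMeasure P] (hg : LpBigO P 1 fun n ω => g n ω - m)
    (hm : m ≠ 0) (r : ℕ) : LpBigO P r fun n ω => 1 - g n ω * (g n ω)⁻¹ := by
  have h := (hg.pow r).const_mul (1 / m ^ r)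
  rw [one_mul] at h
  have hmeas (n : ℕ) : AEStronglyMeasurable (g n) P := by
    simpa using ((hg.allLp n).add (AllLp.const m)).aestronglyMeasurable
  refine h.of_le (fun n => aestronglyMeasurable_const.sub
    ((hmeas n).mul (hmeas n).aemeasurable.inv.aestronglyMeasurable)) fun n => ?_
  filter_upwards with ω
  by_cases h : g n ω = 0
  · rw [h, zero_sub, neg_pow, zero_mul, sub_zero, abs_one, mul_left_comm,
      one_div_mul_cancel (pow_ne_zero r hm)]
    simp
  · rw [mul_inv_cancel₀ h, sub_self, abs_zero]
    positivity

/-- For g ≠ 0, 1/g = 1/m - (g - m)/m² + (g - m)²/(m² g). Where g = 0 the inverse is 0, and the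
linear polynomial has to be subtracted again on that event, whose indicator is negligible. -/
theorem Estimates.inv [IsProbabilityMeasure P] (hg : Estimates P g m) (hm : m ≠ 0)
    (hl : ZeroOrLarge P k b g) (hb : 0 < b) : Estimates P (fun n ω => (g n ω)⁻¹) m⁻¹ := by
  have hi := hg.lpBigO_inv hm hl hb
  have hz : LpBigO P 2 fun n ω => 1 - g n ω * (g n ω)⁻¹ := hg.lpBigO.one_sub_mul_inv hm 2
  have h2 : LpBigO P 2 fun n ω => (1 / m ^ 2 * (g n ω - m) ^ 2 * (g n ω)⁻¹
      - (1 / m - 1 / m ^ 2 * (g n ω - m)) * (1 - g n ω * (g n ω)⁻¹)) := by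
    refine (((hg.lpBigO.pow 2).const_mul (1 / m ^ 2)).mul hi).sub ?_
    have h3 : LpBigO P 0 fun n ω => (1 / m - 1 / m ^ 2 * (g n ω - m)) :=
      (LpBigO.const (1 / m)).sub ((hg.lpBigO.mono zero_le_one).const_mul (1 / m ^ 2))
    simpa using h3.mul hz
  have h4 := (((Estimates.const m).sub hg).const_mul (1 / m ^ 2)).add_lpBigO h2
  simp only [sub_self, mul_zero] at h4
  have h5 := (Estimates.const (P := P) m⁻¹).add h4
  rw [add_zero] at h5
  convert h5 using 3 with n ω
  by_cases h : g n ω = 0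
  · rw [h, inv_zero]
    field_simp
    ring
  · field_simp
    ring

end LpOrder

end Debias

namespace Debias

/-! ### Moments of centred i.i.d. sums and of the errors of sample means. -/

section Moments

variable {Ω : Type*}

theorem meanHat_sub_eq (W : ℕ → Ω → ℝ) (c : ℝ) {n : ℕ} (hn : n ≠ 0) (ω : Ω) :
    meanHat (sample W n ω) - c = (∑ i ∈ Finset.range n, (W i ω - c)) / n := by
  have hn' : (n : ℝ) ≠ 0 := by exact_mod_cast hn
  rw [meanHat, Finset.sum_sub_distrib, Finset.sum_range]
  simp only [sample, Finset.sum_const, Finset.card_range, nsmul_eq_mul]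
  field_simp

variable [MeasurableSpace Ω] {P : Measure Ω}

/-- An i.i.d. sequence of real random variables with finite moments of all orders. -/
structure IIDMoments (P : Measure Ω) (W : ℕ → Ω → ℝ) : Prop where
  indep : iIndepFun W P
  ident : ∀ i, IdentDistrib (W i) (W 0) P P
  allLp_zero : AllLp P (W 0)

/-- An i.i.d. sequence of pairs of real random variables with finite moments of all orders. -/
structure IIDPair (P : Measure Ω) (X Y : ℕ → Ω → ℝ) : Prop where
  iid : IsIID P fun i ω => (X i ω, Y i ω)
  allLp_left : AllLp P (X 0)
  allLp_right : AllLp P (Y 0)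

theorem IIDPair.map {X Y : ℕ → Ω → ℝ} (h : IIDPair P X Y) {φ ψ : ℝ × ℝ → ℝ}
    (hφ : Measurable φ) (hψ : Measurable ψ) (h1 : AllLp P fun ω => φ (X 0 ω, Y 0 ω))
    (h2 : AllLp P fun ω => ψ (X 0 ω, Y 0 ω)) :
    IIDPair P (fun i ω => φ (X i ω, Y i ω)) fun i ω => ψ (X i ω, Y i ω) := by
  refine ⟨⟨?_, fun i => ?_⟩, h1, h2⟩
  · exact h.iid.1.comp (fun _ p => (φ p, ψ p)) fun _ => hφ.prodMk hψ
  · exact (h.iid.2 i).comp (hφ.prodMk hψ)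

theorem IIDPair.comp {X Y : ℕ → Ω → ℝ} (h : IIDPair P X Y) {φ : ℝ × ℝ → ℝ}
    (hφ : Measurable φ) (h1 : AllLp P fun ω => φ (X 0 ω, Y 0 ω)) :
    IIDMoments P fun i ω => φ (X i ω, Y i ω) :=
  ⟨h.iid.1.comp (fun _ => φ) fun _ => hφ, fun i => (h.iid.2 i).comp hφ, h1⟩

theorem IIDPair.left {X Y : ℕ → Ω → ℝ} (h : IIDPair P X Y) : IIDMoments P X :=
  h.comp measurable_fst h.allLp_left

theorem IIDPair.right {X Y : ℕ → Ω → ℝ} (h : IIDPair P X Y) : IIDMoments P Y :=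
  h.comp measurable_snd h.allLp_right

theorem IIDPair.swap {X Y : ℕ → Ω → ℝ} (h : IIDPair P X Y) : IIDPair P Y X :=
  h.map measurable_snd measurable_fst h.allLp_right h.allLp_left

theorem IIDPair.diag {X Y : ℕ → Ω → ℝ} (h : IIDPair P X Y) : IIDPair P X X :=
  h.map measurable_fst measurable_fst h.allLp_left h.allLp_left

namespace IIDMoments

variable {W ξ : ℕ → Ω → ℝ}

theorem allLp (h : IIDMoments P W) (i : ℕ) : AllLp P (W i) :=
  fun q => (h.ident i).memLp_iff.2 (h.allLp_zero q)

theorem pair_self (h : IIDMoments P X) : IIDPair P X X :=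
  ⟨⟨h.indep.comp (fun _ x => (x, x)) fun _ => measurable_id.prodMk measurable_id,
    fun i => (h.ident i).comp (measurable_id.prodMk measurable_id)⟩, h.allLp_zero, h.allLp_zero⟩

theorem sub_const [IsProbabilityMeasure P] (h : IIDMoments P W) (c : ℝ) :
    IIDMoments P fun i ω => W i ω - c :=
  ⟨h.indep.comp (fun _ x => x - c) fun _ => measurable_id.sub_const c,
    fun i => (h.ident i).comp (measurable_id.sub_const c), h.allLp_zero.sub (AllLp.const c)⟩

theorem integral_pow_eq (h : IIDMoments P W) (i m : ℕ) :
    ∫ ω, W i ω ^ m ∂P = ∫ ω, W 0 ω ^ m ∂P :=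
  ((h.ident i).comp (measurable_id.pow_const m)).integral_eq

theorem integral_sum_pow_mul_pow [IsProbabilityMeasure P] (h : IIDMoments P ξ) (n a b : ℕ) :
    ∫ ω, (∑ i ∈ Finset.range n, ξ i ω) ^ a * ξ n ω ^ b ∂P =
      (∫ ω, (∑ i ∈ Finset.range n, ξ i ω) ^ a ∂P) * ∫ ω, ξ 0 ω ^ b ∂P := by
  rw [← h.integral_pow_eq n b]
  have hi := h.indep.indepFun_sum_range_succ₀
    (fun i => (h.allLp i).aestronglyMeasurable.aemeasurable) n
  have hi' := hi.comp (measurable_id.pow_const a) (measurable_id.pow_const b)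
  have := hi'.integral_fun_mul_eq_mul_integral
    (((AllLp.sum (Finset.range n) fun i _ => h.allLp i).pow a).aestronglyMeasurable.congr
      (by filter_upwards with ω; simp [Finset.sum_apply]))
    ((h.allLp n).pow b).aestronglyMeasurable
  simpa [Finset.sum_apply] using this

/-- The newest term is independent of the earlier sum, so the binomial expansion factorises under
the expectation. This recursion in `n` yields the moment bounds below. -/
theorem integral_sum_succ_pow [IsProbabilityMeasure P] (h : IIDMoments P ξ) (n m : ℕ) :
    ∫ ω, (∑ i ∈ Finset.range (n + 1), ξ i ω) ^ m ∂P =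
      ∑ j ∈ Finset.range (m + 1), (∫ ω, (∑ i ∈ Finset.range n, ξ i ω) ^ j ∂P) *
        (∫ ω, ξ 0 ω ^ (m - j) ∂P) * (m.choose j : ℝ) := by
  simp only [Finset.sum_range_succ (fun i => ξ i _), add_pow]
  rw [integral_finsetSum]
  · simp only [integral_mul_const, h.integral_sum_pow_mul_pow]
  · intro j _
    exact ((((AllLp.sum _ fun i _ => h.allLp i).pow j).mul ((h.allLp n).pow (m - j))).mul
      (AllLp.const _)).integrable

theorem integral_sum_sq [IsProbabilityMeasure P] (h : IIDMoments P ξ)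
    (h0 : ∫ ω, ξ 0 ω ∂P = 0) (n : ℕ) :
    ∫ ω, (∑ i ∈ Finset.range n, ξ i ω) ^ 2 ∂P = n * ∫ ω, ξ 0 ω ^ 2 ∂P := by
  induction n with
  | zero => simp
  | succ n ih =>
    rw [h.integral_sum_succ_pow, Finset.sum_range_succ, Finset.sum_range_succ,
      Finset.sum_range_succ, ih]
    simp [h0]
    ring

/-- The `m`-th moment of a sum of `n` centred i.i.d. variables is `O(n ^ ⌊m / 2⌋)`. -/
theorem abs_integral_sum_pow_le [IsProbabilityMeasure P] (h : IIDMoments P ξ)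
    (h0 : ∫ ω, ξ 0 ω ∂P = 0) (m : ℕ) :
    ∃ C : ℝ, 0 ≤ C ∧
      ∀ n : ℕ, |∫ ω, (∑ i ∈ Finset.range n, ξ i ω) ^ m ∂P| ≤ C * (n : ℝ) ^ (m / 2) := by
  induction m using Nat.strong_induction_on with
  | _ m ih =>
  match m with
  | 0 => exact ⟨1, zero_le_one, fun n => by simp⟩
  | 1 =>
    refine ⟨0, le_rfl, fun n => ?_⟩
    have : ∫ ω, ∑ i ∈ Finset.range n, ξ i ω ∂P = 0 := by
      rw [integral_finsetSum _ fun i _ => (h.allLp i).integrable]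
      refine Finset.sum_eq_zero fun i _ => ?_
      rw [← h0]
      exact (h.ident i).integral_eq
    simp [this]
  | p + 2 =>
    choose! C hC0 hC using ih
    -- In the recursion for the moment of order p + 2, exponent p + 2 reproduces the previous moment
    -- and exponent p + 1 drops out by centring. The remaining exponents j ≤ p give an increment of
    -- at most D (n + 1)^(p/2), and these add up to D n^(p/2 + 1).
    set D : ℝ := ∑ j ∈ Finset.range (p + 1),
      C j * |∫ ω, ξ 0 ω ^ (p + 2 - j) ∂P| * ((p + 2).choose j : ℝ) with hD
    have hD0 : 0 ≤ D := Finset.sum_nonneg fun j hj => by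
      have := hC0 j (by have := Finset.mem_range.1 hj; omega)
      positivity
    refine ⟨D, hD0, fun n => ?_⟩
    rw [Nat.add_div_right _ two_pos]
    induction n with
    | zero => simp
    | succ n ihn =>
      rw [h.integral_sum_succ_pow, Finset.sum_range_succ, Finset.sum_range_succ]
      have h1 : p + 2 - (p + 1) = 1 := by omega
      simp only [h1, pow_one, h0, mul_zero, zero_mul, add_zero, Nat.sub_self, pow_zero,
        integral_const, probReal_univ, smul_eq_mul, mul_one, Nat.choose_self, Nat.cast_one]
      have h2 : |∑ j ∈ Finset.range (p + 1), (∫ ω, (∑ i ∈ Finset.range n, ξ i ω) ^ j ∂P) *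
          (∫ ω, ξ 0 ω ^ (p + 2 - j) ∂P) * ((p + 2).choose j : ℝ)| ≤
          D * ((n : ℝ) + 1) ^ (p / 2) := by
        refine (Finset.abs_sum_le_sum_abs _ _).trans ?_
        rw [hD, Finset.sum_mul]
        refine Finset.sum_le_sum fun j hj => ?_
        have hj' : j < p + 1 := Finset.mem_range.1 hj
        rw [abs_mul, abs_mul, Nat.abs_cast]
        have h3 : |∫ ω, (∑ i ∈ Finset.range n, ξ i ω) ^ j ∂P| ≤
            C j * ((n : ℝ) + 1) ^ (p / 2) := by
          refine (hC j (by omega) n).trans (mul_le_mul_of_nonneg_left ?_ (hC0 j (by omega)))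
          calc (n : ℝ) ^ (j / 2) ≤ ((n : ℝ) + 1) ^ (j / 2) := by gcongr; linarith
            _ ≤ ((n : ℝ) + 1) ^ (p / 2) :=
              pow_le_pow_right₀ (by linarith [(Nat.cast_nonneg n : (0 : ℝ) ≤ n)])
                (Nat.div_le_div_right (by omega))
        calc _ ≤ C j * ((n : ℝ) + 1) ^ (p / 2) * |∫ ω, ξ 0 ω ^ (p + 2 - j) ∂P| *
              ((p + 2).choose j : ℝ) := by gcongr
          _ = _ := by ring
      refine (abs_add_le _ _).trans ((add_le_add h2 ihn).trans ?_)
      push_cast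
      have h4 : (n : ℝ) ^ (p / 2) ≤ ((n : ℝ) + 1) ^ (p / 2) := by gcongr; linarith
      rw [pow_succ, pow_succ]
      have h5 : D * ((n : ℝ) ^ (p / 2) * n) ≤ D * (((n : ℝ) + 1) ^ (p / 2) * n) := by gcongr
      linarith

end IIDMoments

theorem eventually_meanHat_sub (W : ℕ → Ω → ℝ) (c : ℝ) (F : ℝ → ℝ) :
    ∀ᶠ n : ℕ in atTop, (fun ω => F (meanHat (sample W n ω) - c)) =ᵐ[P]
      fun ω => F ((∑ i ∈ Finset.range n, (W i ω - c)) / n) := by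
  filter_upwards [eventually_gt_atTop 0] with n hn
  filter_upwards with ω
  rw [meanHat_sub_eq W c hn.ne']

theorem eLpNorm_two_mul_le {f : Ω → ℝ} {r : ℕ} (hr : r ≠ 0) (hf : AllLp P f) {C : ℝ}
    (hC : ∫ ω, f ω ^ (2 * r) ∂P ≤ C) :
    eLpNorm f (2 * r : ℕ) P ≤ (C ^ ((2 * r : ℕ) : ℝ)⁻¹).toNNReal := by
  rw [(hf (2 * r)).eLpNorm_eq_integral_rpow_norm (by simpa using hr) (ENNReal.natCast_ne_top _)]
  simp only [ENNReal.toReal_natCast, Real.rpow_natCast]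
  refine ENNReal.ofReal_le_ofReal (Real.rpow_le_rpow ?_ ?_ (by positivity))
  · exact integral_nonneg fun ω => by positivity
  · refine le_trans (le_of_eq ?_) hC
    congr 1
    ext ω
    rw [pow_mul, pow_mul, Real.norm_eq_abs, sq_abs]

namespace IIDMoments

variable {W ξ : ℕ → Ω → ℝ} [IsProbabilityMeasure P]

/-- The exponent `2 * (q + 1)` dominates `q` and is even, so the norm is an ordinary moment; that
moment of the sum is O(n^(q+1)), which the factor √n/n normalises exactly. -/
theorem lpBigO_sum_div (h : IIDMoments P ξ) (h0 : ∫ ω, ξ 0 ω ∂P = 0) :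
    LpBigO P 1 fun n ω => (∑ i ∈ Finset.range n, ξ i ω) / n := by
  have hA (n : ℕ) : AllLp P fun ω => (∑ i ∈ Finset.range n, ξ i ω) / n := by
    simp only [div_eq_mul_inv]
    exact (AllLp.sum _ fun i _ => h.allLp i).mul (AllLp.const _)
  refine ⟨hA, fun q => ?_⟩
  obtain ⟨C, -, hC⟩ := h.abs_integral_sum_pow_le h0 (2 * (q + 1))
  refine ⟨(C ^ ((2 * (q + 1) : ℕ) : ℝ)⁻¹).toNNReal, ?_⟩
  filter_upwards [eventually_gt_atTop 0] with n hn
  have hn' : (0 : ℝ) < n := by exact_mod_cast hn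
  have hB := (AllLp.const (P := P) (√(n : ℝ) ^ 1)).mul (hA n)
  refine (eLpNorm_le_eLpNorm_of_exponent_le (q := (2 * (q + 1) : ℕ))
    (by exact_mod_cast (by omega)) hB.aestronglyMeasurable).trans
    (eLpNorm_two_mul_le (Nat.succ_ne_zero q) hB ?_)
  have h1 : ∀ ω, (√(n : ℝ) ^ 1 * ((∑ i ∈ Finset.range n, ξ i ω) / n)) ^ (2 * (q + 1)) =
      ((n : ℝ) ^ (q + 1))⁻¹ * (∑ i ∈ Finset.range n, ξ i ω) ^ (2 * (q + 1)) := by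
    intro ω
    rw [pow_one, mul_pow, pow_mul, Real.sq_sqrt hn'.le, div_pow, pow_mul (n : ℝ) 2,
      ← pow_mul, pow_mul (n : ℝ)]
    have : ((n : ℝ) ^ 2) ^ (q + 1) = (n : ℝ) ^ (q + 1) * (n : ℝ) ^ (q + 1) := by ring
    rw [this]
    field_simp
  simp only [h1, integral_const_mul]
  rw [inv_mul_le_iff₀ (by positivity)]
  have := (le_abs_self _).trans (hC n)
  rwa [Nat.mul_div_cancel_left _ two_pos, mul_comm C] at this

/-- The L^q rate would only give n^(-3/2). Centring makes the third moment of the sum O(n), which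
gains the missing half order. -/
theorem meanBigO_sum_div_cube (h : IIDMoments P ξ) (h0 : ∫ ω, ξ 0 ω ∂P = 0) :
    MeanBigO P 2 fun n ω => ((∑ i ∈ Finset.range n, ξ i ω) / n) ^ 3 := by
  refine ⟨fun n => ((h.lpBigO_sum_div h0).allLp n).pow 3, ?_⟩
  obtain ⟨C, -, hC⟩ := h.abs_integral_sum_pow_le h0 3
  refine IsBigO.of_bound C ?_
  filter_upwards [eventually_gt_atTop 0] with n hn
  have hn' : (0 : ℝ) < n := by exact_mod_cast hn
  simp only [div_pow, integral_div]
  rw [norm_div, norm_div, norm_one, norm_pow, norm_pow, Real.norm_natCast,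
    div_le_iff₀ (by positivity), Real.norm_eq_abs]
  refine (hC n).trans (le_of_eq ?_)
  -- The division is that of natural numbers.
  rw [show 3 / 2 = 1 by norm_num]
  field_simp

theorem integral_sub_mean (h : IIDMoments P W) :
    ∫ ω, (W 0 ω - ∫ ω, W 0 ω ∂P) ∂P = 0 := by
  rw [integral_sub h.allLp_zero.integrable (integrable_const _)]
  simp

theorem allLp_meanHat (h : IIDMoments P W) (n : ℕ) :
    AllLp P fun ω => meanHat (sample W n ω) := by
  simp only [meanHat, div_eq_mul_inv, sample]
  exact (AllLp.sum Finset.univ fun (i : Fin n) _ => h.allLp i).mul (AllLp.const _)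

theorem lpBigO_meanHat (h : IIDMoments P W) :
    LpBigO P 1 fun n ω => meanHat (sample W n ω) - ∫ ω, W 0 ω ∂P :=
  ((h.sub_const _).lpBigO_sum_div h.integral_sub_mean).congr
    (fun n => (h.allLp_meanHat n).sub (AllLp.const _)) (eventually_meanHat_sub W _ id)

/-- The sample mean is unbiased for n > 0, hence the arbitrary order `j`. -/
theorem meanBigO_meanHat (h : IIDMoments P W) (j : ℕ) :
    MeanBigO P j fun n ω => meanHat (sample W n ω) - ∫ ω, W 0 ω ∂P := by
  have hs := h.sub_const (∫ ω, W 0 ω ∂P)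
  refine ⟨fun n => (h.allLp_meanHat n).sub (AllLp.const _), ?_⟩
  refine (isBigO_zero _ _).congr' (f₁ := fun _ : ℕ => (0 : ℝ)) ?_ EventuallyEq.rfl
  filter_upwards [eventually_meanHat_sub (P := P) W (∫ ω, W 0 ω ∂P) id] with n hn
  refine Eq.trans ?_ (integral_congr_ae hn).symm
  simp only [id, integral_div]
  rw [integral_finsetSum _ fun i _ => (hs.allLp i).integrable, Finset.sum_eq_zero, zero_div]
  intro i _
  exact (hs.ident i).integral_eq.trans h.integral_sub_mean

theorem estimates_meanHat (h : IIDMoments P W) :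
    Estimates P (fun n ω => meanHat (sample W n ω)) (∫ ω, W 0 ω ∂P) :=
  ⟨h.lpBigO_meanHat, h.meanBigO_meanHat 1⟩

theorem meanBigO_meanHat_cube (h : IIDMoments P W) :
    MeanBigO P 2 fun n ω => (meanHat (sample W n ω) - ∫ ω, W 0 ω ∂P) ^ 3 :=
  ((h.sub_const _).meanBigO_sum_div_cube h.integral_sub_mean).congr
    (fun n => ((h.allLp_meanHat n).sub (AllLp.const _)).pow 3)
    (eventually_meanHat_sub W _ fun x => x ^ 3)

theorem meanBigO_meanHat_sq (h : IIDMoments P W) :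
    MeanBigO P 2 fun n ω => (meanHat (sample W n ω) - ∫ ω, W 0 ω ∂P) ^ 2 -
      1 / (n : ℝ) * ((∫ ω, W 0 ω ^ 2 ∂P) - (∫ ω, W 0 ω ∂P) ^ 2) := by
  have hs := h.sub_const (∫ ω, W 0 ω ∂P)
  have hA (n : ℕ) := ((h.allLp_meanHat n).sub (AllLp.const (∫ ω, W 0 ω ∂P))).pow 2
  refine ⟨fun n => (hA n).sub (AllLp.const _), ?_⟩
  refine (isBigO_zero _ _).congr' (f₁ := fun _ : ℕ => (0 : ℝ)) ?_ EventuallyEq.rfl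
  filter_upwards [eventually_meanHat_sub (P := P) W (∫ ω, W 0 ω ∂P) (fun x => x ^ 2),
    eventually_gt_atTop 0] with n hn hn0
  have hn' : (0 : ℝ) < n := by exact_mod_cast hn0
  rw [integral_sub (hA n).integrable (integrable_const _), integral_congr_ae hn]
  simp only [div_pow, integral_div]
  rw [hs.integral_sum_sq h.integral_sub_mean]
  have hv : ∫ ω, (W 0 ω - ∫ ω, W 0 ω ∂P) ^ 2 ∂P =
      (∫ ω, W 0 ω ^ 2 ∂P) - (∫ ω, W 0 ω ∂P) ^ 2 := by
    have h2 := h.allLp_zero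
    have e : ∀ ω, (W 0 ω - ∫ ω, W 0 ω ∂P) ^ 2 =
        W 0 ω ^ 2 - (2 * (∫ ω, W 0 ω ∂P) * W 0 ω - (∫ ω, W 0 ω ∂P) ^ 2) := fun ω => by ring
    simp only [e]
    rw [integral_sub (h2.pow 2).integrable
      (((AllLp.const _).mul h2).sub (AllLp.const _)).integrable,
      integral_sub ((AllLp.const _).mul h2).integrable (integrable_const _), integral_const_mul]
    simp
    ring
  rw [hv]
  simp
  field_simp
  ring

end IIDMoments

theorem meanHat_add {n : ℕ} (x y : Fin n → ℝ) :
    meanHat (fun i => x i + y i) = meanHat x + meanHat y := by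
  simp only [meanHat, Finset.sum_add_distrib, add_div]

theorem meanHat_sub {n : ℕ} (x y : Fin n → ℝ) :
    meanHat (fun i => x i - y i) = meanHat x - meanHat y := by
  simp only [meanHat, Finset.sum_sub_distrib, sub_div]

namespace IIDPair

variable {X Y : ℕ → Ω → ℝ}

theorem iidMoments_add (h : IIDPair P X Y) : IIDMoments P fun i ω => X i ω + Y i ω :=
  h.comp (φ := fun p => p.1 + p.2) (by fun_prop) (h.allLp_left.add h.allLp_right)

theorem iidMoments_sub (h : IIDPair P X Y) : IIDMoments P fun i ω => X i ω - Y i ω :=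
  h.comp (φ := fun p => p.1 - p.2) (by fun_prop) (h.allLp_left.sub h.allLp_right)

theorem iidMoments_mul (h : IIDPair P X Y) : IIDMoments P fun i ω => X i ω * Y i ω :=
  h.comp (φ := fun p => p.1 * p.2) (by fun_prop) (h.allLp_left.mul h.allLp_right)

variable [IsProbabilityMeasure P]

/-- Polarisation, 4xy = (x + y)² - (x - y)², applied to the i.i.d. sequences X + Y and X - Y. -/
theorem meanBigO_meanHat_mul (h : IIDPair P X Y) :
    MeanBigO P 2 fun n ω => (meanHat (sample X n ω) - ∫ ω, X 0 ω ∂P) *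
      (meanHat (sample Y n ω) - ∫ ω, Y 0 ω ∂P) -
      1 / (n : ℝ) * ((∫ ω, X 0 ω * Y 0 ω ∂P) - (∫ ω, X 0 ω ∂P) * ∫ ω, Y 0 ω ∂P) := by
  have ha := h.iidMoments_add.meanBigO_meanHat_sq
  have hs := h.iidMoments_sub.meanBigO_meanHat_sq
  have hX := h.allLp_left
  have hY := h.allLp_right
  have hXY := hX.mul hY
  convert (ha.sub hs).const_mul (1 / 4) using 3 with n ω
  have e1 : ∫ ω, (X 0 ω + Y 0 ω) ^ 2 ∂P =
      (∫ ω, X 0 ω ^ 2 ∂P) + 2 * (∫ ω, X 0 ω * Y 0 ω ∂P) + ∫ ω, Y 0 ω ^ 2 ∂P := by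
    have e (ω) : (X 0 ω + Y 0 ω) ^ 2 = X 0 ω ^ 2 + 2 * (X 0 ω * Y 0 ω) + Y 0 ω ^ 2 := by ring
    simp only [e]
    rw [integral_add ((hX.pow 2).add ((AllLp.const 2).mul hXY)).integrable (hY.pow 2).integrable,
      integral_add (hX.pow 2).integrable ((AllLp.const 2).mul hXY).integrable, integral_const_mul]
  have e2 : ∫ ω, (X 0 ω - Y 0 ω) ^ 2 ∂P =
      (∫ ω, X 0 ω ^ 2 ∂P) - 2 * (∫ ω, X 0 ω * Y 0 ω ∂P) + ∫ ω, Y 0 ω ^ 2 ∂P := by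
    have e (ω) : (X 0 ω - Y 0 ω) ^ 2 = X 0 ω ^ 2 - 2 * (X 0 ω * Y 0 ω) + Y 0 ω ^ 2 := by ring
    simp only [e]
    rw [integral_add ((hX.pow 2).sub ((AllLp.const 2).mul hXY)).integrable (hY.pow 2).integrable,
      integral_sub (hX.pow 2).integrable ((AllLp.const 2).mul hXY).integrable, integral_const_mul]
  have e3 : meanHat (sample (fun i ω => X i ω + Y i ω) n ω) =
    meanHat (sample X n ω) + meanHat (sample Y n ω) := meanHat_add _ _
  have e4 : meanHat (sample (fun i ω => X i ω - Y i ω) n ω) =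
    meanHat (sample X n ω) - meanHat (sample Y n ω) := meanHat_sub _ _
  rw [e1, e2, e3, e4, integral_add hX.integrable hY.integrable,
    integral_sub hX.integrable hY.integrable]
  ring

/-- Cubic polarisation: 6x²y = (x + y)³ - (x - y)³ - 2y³. -/
theorem meanBigO_meanHat_sq_mul (h : IIDPair P X Y) :
    MeanBigO P 2 fun n ω => (meanHat (sample X n ω) - ∫ ω, X 0 ω ∂P) ^ 2 *
      (meanHat (sample Y n ω) - ∫ ω, Y 0 ω ∂P) := by
  have ha := h.iidMoments_add.meanBigO_meanHat_cube
  have hs := h.iidMoments_sub.meanBigO_meanHat_cube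
  have hy := h.right.meanBigO_meanHat_cube
  convert ((ha.sub hs).sub (hy.const_mul 2)).const_mul (1 / 6) using 3 with n ω
  have e3 : meanHat (sample (fun i ω => X i ω + Y i ω) n ω) =
    meanHat (sample X n ω) + meanHat (sample Y n ω) := meanHat_add _ _
  have e4 : meanHat (sample (fun i ω => X i ω - Y i ω) n ω) =
    meanHat (sample X n ω) - meanHat (sample Y n ω) := meanHat_sub _ _
  rw [e3, e4, integral_add h.allLp_left.integrable h.allLp_right.integrable,
    integral_sub h.allLp_left.integrable h.allLp_right.integrable]
  ring

end IIDPair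

end Moments

end Debias

namespace Debias

/-! ### Deterministic lower bounds and algebraic identities for the sample statistics. -/

section SampleStatistics

variable {n m : ℕ}

theorem sum_zero_or_large {ι : Type*} (s : Finset ι) {f : ι → ℝ} {b : ℝ} (hb : 0 < b)
    (hf : ∀ i ∈ s, f i = 0 ∨ b ≤ f i) : ∑ i ∈ s, f i = 0 ∨ b ≤ ∑ i ∈ s, f i := by
  by_cases h : ∀ i ∈ s, f i = 0
  · exact Or.inl (Finset.sum_eq_zero h)
  · push Not at h
    obtain ⟨i, hi, hne⟩ := h
    refine Or.inr (((hf i hi).resolve_left hne).trans (Finset.single_le_sum (fun j hj => ?_) hi))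
    rcases hf j hj with h | h
    · exact h.ge
    · linarith

/-- All terms are nonnegative, so one nonzero tuple already contributes `b`; the average divides
this by at most n^m. -/
theorem uStat_zero_or_large {g : (Fin m → Fin n) → ℝ} {b : ℝ} (hb : 0 < b)
    (hg : ∀ e, g e = 0 ∨ b ≤ g e) : uStat g = 0 ∨ b ≤ (n : ℝ) ^ m * |uStat g| := by
  rcases sum_zero_or_large (Finset.univ : Finset (Fin m ↪ Fin n)) (f := fun e => g e) hb
    (fun e _ => hg e) with h | h
  · exact Or.inl (by rw [uStat, h, zero_div])
  · rcases Nat.eq_zero_or_pos (n.descFactorial m) with h0 | h0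
    · exact Or.inl (by rw [uStat, h0, Nat.cast_zero, div_zero])
    · right
      have h0' : (0 : ℝ) < n.descFactorial m := by exact_mod_cast h0
      have hle : (n.descFactorial m : ℝ) ≤ (n : ℝ) ^ m := by
        exact_mod_cast Nat.descFactorial_le_pow n m
      rw [uStat, abs_of_nonneg (div_nonneg (hb.le.trans h) h0'.le), ← mul_div_assoc,
        le_div_iff₀ h0', mul_comm]
      gcongr

/-- An average of values at least `b` loses nothing; the value 0 occurs only when there are no
tuples, that is n < m. -/
theorem uStat_zero_or_le {g : (Fin m → Fin n) → ℝ} {b : ℝ} (hb : 0 < b)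
    (hg : ∀ e, b ≤ g e) : uStat g = 0 ∨ b ≤ |uStat g| := by
  rcases Nat.eq_zero_or_pos (n.descFactorial m) with h0 | h0
  · exact Or.inl (by rw [uStat, h0, Nat.cast_zero, div_zero])
  · right
    have h0' : (0 : ℝ) < n.descFactorial m := by exact_mod_cast h0
    have h : b * n.descFactorial m ≤ ∑ e : Fin m ↪ Fin n, g e := by
      calc b * n.descFactorial m = ∑ _e : Fin m ↪ Fin n, b := by
            simp [Fintype.card_embedding_eq, mul_comm]
        _ ≤ _ := Finset.sum_le_sum fun e _ => hg e
    rw [uStat, abs_of_nonneg (div_nonneg (le_trans (by positivity) h) h0'.le),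
      le_div_iff₀ h0']
    exact h

theorem meanHat_zero_or_large {y : Fin n → ℝ} {b : ℝ} (hb : 0 < b)
    (hy : ∀ i, y i = 0 ∨ b ≤ y i) : meanHat y = 0 ∨ b ≤ (n : ℝ) ^ 1 * |meanHat y| := by
  rcases Nat.eq_zero_or_pos n with h0 | h0
  · exact Or.inl (by simp [meanHat, h0])
  have h0' : (0 : ℝ) < n := by exact_mod_cast h0
  rcases sum_zero_or_large Finset.univ hb (fun i _ => hy i) with h | h
  · exact Or.inl (by rw [meanHat, h, zero_div])
  · right
    rw [meanHat, abs_of_nonneg (div_nonneg (hb.le.trans h) h0'.le), pow_one,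
      mul_div_cancel₀ _ h0'.ne']
    exact h

theorem meanHat_zero_or_le {x : Fin n → ℝ} {b : ℝ} (hb : 0 < b)
    (hx : ∀ i, b ≤ x i) : meanHat x = 0 ∨ b ≤ |meanHat x| := by
  rcases Nat.eq_zero_or_pos n with h0 | h0
  · exact Or.inl (by simp [meanHat, h0])
  have h0' : (0 : ℝ) < n := by exact_mod_cast h0
  have h : b * n ≤ ∑ i, x i := by
    calc b * n = ∑ _i : Fin n, b := by simp [mul_comm]
      _ ≤ _ := Finset.sum_le_sum fun i _ => hx i
  right
  rw [meanHat, abs_of_nonneg (div_nonneg (le_trans (by positivity) h) h0'.le),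
    le_div_iff₀ h0']
  exact h

theorem prod_zero_or_large {k : ℕ} {f : Fin k → ℝ} {b : ℝ} (hb : 0 < b)
    (hf : ∀ i, f i = 0 ∨ b ≤ f i) : ∏ i, f i = 0 ∨ b ^ k ≤ ∏ i, f i := by
  by_cases h : ∃ i, f i = 0
  · obtain ⟨i, hi⟩ := h
    exact Or.inl (Finset.prod_eq_zero (Finset.mem_univ i) hi)
  · push Not at h
    right
    calc b ^ k = ∏ _i : Fin k, b := by simp
      _ ≤ _ := Finset.prod_le_prod (fun _ _ => hb.le) fun i _ => (hf i).resolve_left (h i)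

theorem sum_embedding_fin_two {F : Fin n → Fin n → ℝ} :
    ∑ e : Fin 2 ↪ Fin n, F (e 0) (e 1) = (∑ i, ∑ j, F i j) - ∑ i, F i i := by
  have h1 : ∑ e : Fin 2 ↪ Fin n, F (e 0) (e 1) =
      ∑ p ∈ (Finset.univ : Finset (Fin n)).offDiag, F p.1 p.2 := by
    refine Finset.sum_bij' (fun e _ => (e 0, e 1))
      (fun p hp => ⟨![p.1, p.2], fun a b hab => ?_⟩) ?_ ?_ ?_ ?_ ?_
    · have hne := (Finset.mem_offDiag.1 hp).2.2
      fin_cases a <;> fin_cases b <;> simp_all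
    · intro e _
      simp
    · simp
    · intro e _
      ext i
      fin_cases i <;> rfl
    · intro p _
      rfl
    · intro e _
      rfl
  rw [h1, eq_sub_iff_add_eq, ← Finset.sum_product', ← Finset.diag_union_offDiag,
    Finset.sum_union (Finset.disjoint_diag_offDiag _), Finset.sum_diag, add_comm]

/-- The sum over i ≠ j is the full double sum minus its diagonal, so the deviation from the product
of means is a plug-in covariance with a factor 1/(n - 1). -/
theorem meanProdHat_eq (hn : 2 ≤ n) (x y : Fin n → ℝ) :
    meanProdHat x y = meanHat x * meanHat y -
      1 / ((n : ℝ) - 1) * (meanHat (fun i => x i * y i) - meanHat x * meanHat y) := by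
  have h1 : (2 : ℝ) ≤ n := by exact_mod_cast hn
  have h2 : (n : ℝ) - 1 ≠ 0 := by linarith
  have h3 : (n : ℝ) ≠ 0 := by linarith
  rw [meanProdHat, uStat, sum_embedding_fin_two (F := fun i j => x i * y j),
    Nat.cast_descFactorial_two, ← Finset.sum_mul_sum]
  simp only [meanHat]
  field_simp
  ring

theorem meanPowHat_two (x : Fin n → ℝ) : meanPowHat 2 x = meanProdHat x x := by
  simp only [meanPowHat, meanProdHat, Fin.prod_univ_two]

theorem covHat_eq (hn : 2 ≤ n) (x y : Fin n → ℝ) :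
    covHat x y = (1 + 1 / ((n : ℝ) - 1)) *
      (meanHat (fun i => x i * y i) - meanHat x * meanHat y) := by
  have h1 : (2 : ℝ) ≤ n := by exact_mod_cast hn
  have h2 : (n : ℝ) - 1 ≠ 0 := by linarith
  have h3 : (n : ℝ) ≠ 0 := by linarith
  have h4 : ∑ i, (x i - meanHat x) * (y i - meanHat y) =
      (∑ i, x i * y i) - n * (meanHat x * meanHat y) := by
    have hx : ∑ i, x i = n * meanHat x := by rw [meanHat]; field_simp
    have hy : ∑ i, y i = n * meanHat y := by rw [meanHat]; field_simp
    have e (i) : (x i - meanHat x) * (y i - meanHat y) =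
      x i * y i - x i * meanHat y - meanHat x * y i + meanHat x * meanHat y := by ring
    simp only [e, Finset.sum_add_distrib, Finset.sum_sub_distrib, ← Finset.sum_mul,
      ← Finset.mul_sum, hx, hy]
    simp
    ring
  have h5 : ∑ i, x i * y i = n * meanHat (fun i => x i * y i) := by rw [meanHat]; field_simp
  rw [covHat, h4, h5]
  field_simp
  ring

/-- The bound splits into functions of single sample points. As these are identically distributed,
the kernel is bounded in L^q uniformly over all index tuples. -/
theorem abs_covSq_kernel_le (a b c d a' b' c' d' : ℝ) :
    |((a - b) * (a' - b') / 2) * ((c - d) * (c' - d') / 2)| ≤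
      (a ^ 2 + a' ^ 2) ^ 2 + (b ^ 2 + b' ^ 2) ^ 2 + (c ^ 2 + c' ^ 2) ^ 2 +
        (d ^ 2 + d' ^ 2) ^ 2 := by
  have key (s t s' t' : ℝ) :
      |(s - t) * (s' - t') / 2| ≤ (s ^ 2 + s' ^ 2) + (t ^ 2 + t' ^ 2) := by
    rw [abs_le]
    constructor <;>
      nlinarith [sq_nonneg (s - t + (s' - t')), sq_nonneg (s - t - (s' - t')),
        sq_nonneg (s + t), sq_nonneg (s' + t')]
  rw [abs_mul]
  refine (mul_le_mul (key a b a' b') (key c d c' d') (abs_nonneg _) (by positivity)).trans ?_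
  nlinarith [sq_nonneg (a ^ 2 + a' ^ 2 + (b ^ 2 + b' ^ 2) - (c ^ 2 + c' ^ 2 + (d ^ 2 + d' ^ 2))),
    sq_nonneg (a ^ 2 + a' ^ 2 - (b ^ 2 + b' ^ 2)), sq_nonneg (c ^ 2 + c' ^ 2 - (d ^ 2 + d' ^ 2))]

end SampleStatistics

/-! ### Rates and biases of the covariance and product estimators. -/

section Estimators

variable {Ω : Type*} [MeasurableSpace Ω] {P : Measure Ω} [IsProbabilityMeasure P]
  {X Y : ℕ → Ω → ℝ}

theorem AllLp.uStat {n m : ℕ} {G : (Fin m → Fin n) → Ω → ℝ} (hG : ∀ e, AllLp P (G e)) :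
    AllLp P fun ω => uStat fun e => G e ω := by
  simp only [Debias.uStat, div_eq_mul_inv]
  exact (AllLp.sum Finset.univ fun (e : Fin m ↪ Fin n) _ => hG e).mul (AllLp.const _)

/-- Minkowski's inequality for an average: no cancellation between tuples is used, hence only order
0. -/
theorem lpBigO_uStat {m : ℕ} {G : ∀ n, (Fin m → Fin n) → Ω → ℝ} (hG : ∀ n e, AllLp P (G n e))
    {C : ℕ → ℝ≥0} (hC : ∀ q n e, eLpNorm (G n e) (q + 1 : ℕ) P ≤ C q) :
    LpBigO P 0 fun n ω => uStat fun e => G n e ω := by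
  refine ⟨fun n => AllLp.uStat (hG n), fun q => ⟨C q, Eventually.of_forall fun n => ?_⟩⟩
  simp only [pow_zero, one_mul]
  refine (eLpNorm_le_eLpNorm_of_exponent_le (q := (q + 1 : ℕ)) (by simp)
    (AllLp.uStat (hG n)).aestronglyMeasurable).trans ?_
  have e1 : (fun ω => uStat fun e => G n e ω) =
      (n.descFactorial m : ℝ)⁻¹ • ∑ e : Fin m ↪ Fin n, G n e := by
    ext ω
    simp [uStat, Finset.sum_apply, div_eq_inv_mul]
  rw [e1, eLpNorm_const_smul]
  have h1 : eLpNorm (∑ e : Fin m ↪ Fin n, G n e) (q + 1 : ℕ) P ≤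
      (n.descFactorial m : ℝ≥0∞) * C q := by
    calc eLpNorm (∑ e : Fin m ↪ Fin n, G n e) (q + 1 : ℕ) P
        ≤ ∑ e : Fin m ↪ Fin n, eLpNorm (G n e) (q + 1 : ℕ) P :=
          eLpNorm_sum_le (s := Finset.univ) (f := fun e : Fin m ↪ Fin n => G n e)
            (fun e _ => (hG n e).aestronglyMeasurable) (by simp)
      _ ≤ ∑ _e : Fin m ↪ Fin n, (C q : ℝ≥0∞) := Finset.sum_le_sum fun e _ => hC q n e
      _ = (n.descFactorial m : ℝ≥0∞) * C q := by simp [Fintype.card_embedding_eq]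
  refine (mul_le_mul_right h1 _).trans ?_
  rw [← mul_assoc]
  refine mul_le_of_le_one_left' ?_
  rcases Nat.eq_zero_or_pos (n.descFactorial m) with h0 | h0
  · simp [h0]
  · rw [enorm_inv (by exact_mod_cast h0.ne'), Real.enorm_natCast]
    exact ENNReal.inv_mul_le_one _

namespace IIDPair

theorem allLp_covHat (h : IIDPair P X Y) (n : ℕ) :
    AllLp P fun ω => covHat (sample X n ω) (sample Y n ω) := by
  simp only [covHat, div_eq_mul_inv]
  exact (AllLp.sum Finset.univ fun (i : Fin n) _ =>
    ((h.left.allLp i).sub (h.left.allLp_meanHat n)).mul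
      ((h.right.allLp i).sub (h.right.allLp_meanHat n))).mul (AllLp.const _)

theorem allLp_meanProdHat (h : IIDPair P X Y) (n : ℕ) :
    AllLp P fun ω => meanProdHat (sample X n ω) (sample Y n ω) :=
  AllLp.uStat fun e => (h.left.allLp (e 0)).mul (h.right.allLp (e 1))

theorem _root_.Debias.IIDMoments.allLp_meanPowHat (h : IIDMoments P X) (m n : ℕ) :
    AllLp P fun ω => meanPowHat m (sample X n ω) :=
  AllLp.uStat fun e => AllLp.prod _ fun k _ => h.allLp (e k)

end IIDPair

theorem one_div_sub_one_isBigO :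
    (fun n : ℕ => 1 / ((n : ℝ) - 1)) =O[atTop] fun n : ℕ => 1 / (n : ℝ) ^ 1 := by
  refine IsBigO.of_bound 2 ?_
  filter_upwards [eventually_ge_atTop 2] with n hn
  have h1 : (2 : ℝ) ≤ n := by exact_mod_cast hn
  rw [pow_one, Real.norm_of_nonneg (by apply div_nonneg <;> linarith),
    Real.norm_of_nonneg (by positivity), mul_one_div,
    div_le_div_iff₀ (by linarith) (by linarith)]
  linarith

theorem one_div_isBigO :
    (fun n : ℕ => 1 / (n : ℝ)) =O[atTop] fun n : ℕ => 1 / (n : ℝ) ^ 1 := by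
  simpa using isBigO_refl (fun n : ℕ => (n : ℝ)⁻¹) atTop

namespace IIDPair

/-- The difference between the plug-in covariance and the covariance. -/
theorem estimates_plugin_cov (h : IIDPair P X Y) :
    Estimates P (fun n ω => meanHat (fun i => sample X n ω i * sample Y n ω i) -
      meanHat (sample X n ω) * meanHat (sample Y n ω))
      ((∫ ω, X 0 ω * Y 0 ω ∂P) - (∫ ω, X 0 ω ∂P) * ∫ ω, Y 0 ω ∂P) :=
  h.iidMoments_mul.estimates_meanHat.sub
    (h.left.estimates_meanHat.mul h.right.estimates_meanHat)

theorem estimates_covHat (h : IIDPair P X Y) :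
    Estimates P (fun n ω => covHat (sample X n ω) (sample Y n ω))
      ((∫ ω, X 0 ω * Y 0 ω ∂P) - (∫ ω, X 0 ω ∂P) * ∫ ω, Y 0 ω ∂P) := by
  have hp := h.estimates_plugin_cov
  refine (hp.add_lpBigO ((LpBigO.const_det one_div_sub_one_isBigO).mul hp.lpBigO_zero)).congr
    h.allLp_covHat ?_
  filter_upwards [eventually_ge_atTop 2] with n hn
  filter_upwards with ω
  rw [covHat_eq hn]
  ring

theorem estimates_meanProdHat (h : IIDPair P X Y) :
    Estimates P (fun n ω => meanProdHat (sample X n ω) (sample Y n ω))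
      ((∫ ω, X 0 ω ∂P) * ∫ ω, Y 0 ω ∂P) := by
  refine ((h.left.estimates_meanHat.mul h.right.estimates_meanHat).add_lpBigO
    ((LpBigO.const_det one_div_sub_one_isBigO).mul h.estimates_plugin_cov.lpBigO_zero).neg).congr
    h.allLp_meanProdHat ?_
  filter_upwards [eventually_ge_atTop 2] with n hn
  filter_upwards with ω
  rw [meanProdHat_eq hn]
  ring

/-- Bounded moments suffice, since this statistic enters the correction only with a factor 1/(n(n -
1)). -/
theorem lpBigO_covSqHat (h : IIDPair P X Y) :
    LpBigO P 0 fun n ω => covSqHat (sample X n ω) (sample Y n ω) := by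
  have hZ : IIDMoments P fun i ω => (X i ω ^ 2 + Y i ω ^ 2) ^ 2 :=
    h.comp (φ := fun p => (p.1 ^ 2 + p.2 ^ 2) ^ 2) (by fun_prop)
      (((h.allLp_left.pow 2).add (h.allLp_right.pow 2)).pow 2)
  refine lpBigO_uStat (C := fun q =>
    (4 * eLpNorm (fun ω => (X 0 ω ^ 2 + Y 0 ω ^ 2) ^ 2) (q + 1 : ℕ) P).toNNReal)
    (fun n e => ?_) fun q n e => ?_
  · have hx (i : Fin n) := h.left.allLp i
    have hy (i : Fin n) := h.right.allLp i
    simp only [div_eq_mul_inv, sample]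
    exact ((((hx _).sub (hx _)).mul ((hy _).sub (hy _))).mul (AllLp.const _)).mul
      ((((hx _).sub (hx _)).mul ((hy _).sub (hy _))).mul (AllLp.const _))
  · rw [ENNReal.coe_toNNReal (ENNReal.mul_ne_top (by simp) (hZ.allLp_zero _).2.ne)]
    refine (eLpNorm_mono_real (g := ∑ k : Fin 4, fun ω =>
      (X (e k) ω ^ 2 + Y (e k) ω ^ 2) ^ 2) fun ω => ?_).trans ?_
    · rw [Finset.sum_apply, Fin.sum_univ_four]
      exact abs_covSq_kernel_le _ _ _ _ _ _ _ _
    · refine (eLpNorm_sum_le (fun k _ => (hZ.allLp (e k)).aestronglyMeasurable) (by simp)).trans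
        (le_of_eq ?_)
      simp only [fun k => (hZ.ident (e k : ℕ)).eLpNorm_eq (p := ((q + 1 : ℕ) : ℝ≥0∞))]
      simp

end IIDPair

end Estimators

end Debias

namespace Debias

/-! ### Second-order expansion of the expectation of a ratio. -/

section Ratio

variable {Ω : Type*} [MeasurableSpace Ω] {P : Measure Ω}

/-- Control of the moments up to order three of the errors of a pair of estimators `U`, `V` of
`m`, `m'`: up to `O(1 / n ^ 2)`, the biases and the third moments vanish, the variance of `U` is
`s / n` and the covariance is `t / n`. -/
structure SecondOrder (P : Measure Ω) (U V : ℕ → Ω → ℝ) (m m' s t : ℝ) : Prop where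
  left : LpBigO P 1 fun n ω => U n ω - m
  right : LpBigO P 1 fun n ω => V n ω - m'
  mean_left : MeanBigO P 2 fun n ω => U n ω - m
  mean_right : MeanBigO P 2 fun n ω => V n ω - m'
  mean_sq : MeanBigO P 2 fun n ω => (U n ω - m) ^ 2 - 1 / (n : ℝ) * s
  mean_mul : MeanBigO P 2 fun n ω => (U n ω - m) * (V n ω - m') - 1 / (n : ℝ) * t
  mean_cube : MeanBigO P 2 fun n ω => (U n ω - m) ^ 3
  mean_sq_mul : MeanBigO P 2 fun n ω => (U n ω - m) ^ 2 * (V n ω - m')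

variable {U V : ℕ → Ω → ℝ} {m m' s t : ℝ}

theorem SecondOrder.estimates_left (h : SecondOrder P U V m m' s t) : Estimates P U m :=
  ⟨h.left, h.mean_left.mono one_le_two⟩

theorem SecondOrder.estimates_right (h : SecondOrder P U V m m' s t) : Estimates P V m' :=
  ⟨h.right, h.mean_right.mono one_le_two⟩

/-- The error of the U-statistic for a squared mean, without its linear part. -/
noncomputable def sqMeanRemainder (P : Measure Ω) (X : ℕ → Ω → ℝ) (n : ℕ) (ω : Ω) : ℝ :=
  meanPowHat 2 (sample X n ω) - (∫ ω, X 0 ω ∂P) ^ 2 -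
    2 * (∫ ω, X 0 ω ∂P) * (meanHat (sample X n ω) - ∫ ω, X 0 ω ∂P)

/-- The part of `sqMeanRemainder` of order `n ^ (-3/2)`. -/
noncomputable def sqMeanTail (P : Measure Ω) (X : ℕ → Ω → ℝ) (n : ℕ) (ω : Ω) : ℝ :=
  sqMeanRemainder P X n ω - ((meanHat (sample X n ω) - ∫ ω, X 0 ω ∂P) ^ 2 -
    1 / (n : ℝ) * ((∫ ω, X 0 ω ^ 2 ∂P) - (∫ ω, X 0 ω ∂P) ^ 2))

theorem sqMeanRemainder_eq (P : Measure Ω) (X : ℕ → Ω → ℝ) : sqMeanRemainder P X = fun n ω =>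
    ((meanHat (sample X n ω) - ∫ ω, X 0 ω ∂P) ^ 2 -
      1 / (n : ℝ) * ((∫ ω, X 0 ω ^ 2 ∂P) - (∫ ω, X 0 ω ∂P) ^ 2)) + sqMeanTail P X n ω := by
  funext n ω
  rw [sqMeanTail]
  ring

variable [IsProbabilityMeasure P]

/-- Second order expansion of the expectation of a ratio. -/
theorem SecondOrder.meanBigO_ratio (h : SecondOrder P U V m m' s t) (hm : m ≠ 0)
    (hi : LpBigO P 0 fun n ω => (U n ω)⁻¹) :
    MeanBigO P 2 fun n ω => V n ω * (U n ω)⁻¹ - m' / m -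
      1 / (n : ℝ) * (m' * s / m ^ 3 - t / m ^ 2) := by
  have hV := h.estimates_right.lpBigO_zero
  have hz := h.left.one_sub_mul_inv hm 4
  have hu0 := h.left.mono zero_le_one
  -- Let p be this cubic Taylor polynomial of 1/u at `m`. Then U⁻¹ = p + (U - m)⁴/(m⁴U) - p (1 - U
  -- U⁻¹) holds also at U = 0, where the last term removes p.
  have hp : LpBigO P 0 fun n ω => 1 / m - 1 / m ^ 2 * (U n ω - m) + 1 / m ^ 3 * (U n ω - m) ^ 2 -
      1 / m ^ 4 * (U n ω - m) ^ 3 :=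
    (((LpBigO.const _).sub (hu0.const_mul _)).add (by simpa using (hu0.pow 2).const_mul _)).sub
      (by simpa using (hu0.pow 3).const_mul _)
  have e1 : LpBigO P 4 fun n ω => V n ω * ((1 / m ^ 4) * ((U n ω - m) ^ 4 * (U n ω)⁻¹)) :=
    (hV.mul (((h.left.pow 4).mul hi).const_mul (1 / m ^ 4))).mono (by norm_num)
  have e2 := (hV.mul hp).mul hz
  have e3 : LpBigO P 4 fun n ω => (1 / m ^ 4) * ((V n ω - m') * (U n ω - m) ^ 3) :=
    (h.right.mul (h.left.pow 3)).const_mul _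
  have e := MeanBigO.of_lpBigO (j := 2) ((e1.sub (e2.mono (by norm_num))).sub e3)
  -- Writing V = m' + (V - m') in Vp, `l1`, `l2`, `l3` collect the terms of degree one, two and
  -- three in the errors; the term of degree four is `e3`.
  have l1 := (h.mean_right.const_mul (1 / m)).sub (h.mean_left.const_mul (m' / m ^ 2))
  have l2 := (h.mean_sq.const_mul (m' / m ^ 3)).sub (h.mean_mul.const_mul (1 / m ^ 2))
  have l3 := (h.mean_sq_mul.const_mul (1 / m ^ 3)).sub (h.mean_cube.const_mul (m' / m ^ 4))
  convert ((e.add l1).add l2).add l3 using 3 with n ω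
  by_cases hU : U n ω = 0
  · rw [hU]
    field_simp
    ring
  · field_simp
    ring

theorem hasBiasOrderTwo_of_meanBigO {T : ℕ → Ω → ℝ} {R : ℝ}
    (h : MeanBigO P 2 fun n ω => T n ω - R) : HasBiasOrderTwo P T R := by
  have hT (n : ℕ) : Integrable (T n) P := by
    simpa using ((h.allLp n).add (AllLp.const R)).integrable
  refine ⟨hT, h.isBigO.congr_left fun n => ?_⟩
  rw [integral_sub (hT n) (integrable_const R)]
  simp

/-- A ratio of estimators, multiplied by a factor that corrects the leading term of its bias. -/
theorem SecondOrder.hasBiasOrderTwo (h : SecondOrder P U V m m' s t) (hm : m ≠ 0) {k : ℕ} {b : ℝ}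
    (hl : ZeroOrLarge P k b U) (hb : 0 < b) {T ra rb rem : ℕ → Ω → ℝ} {ca cb κ : ℝ}
    (hra : Estimates P ra ca) (hrb : Estimates P rb cb) (hrem : LpBigO P 4 rem)
    (hκ : m' * s / m ^ 3 - t / m ^ 2 = κ * (m' / m * (cb - ca)))
    (hT : ∀ n, AllLp P (T n))
    (hTe : ∀ᶠ n : ℕ in atTop, ∀ ω, T n ω = V n ω * (U n ω)⁻¹ *
      (1 + κ * (1 / (n : ℝ)) * (ra n ω - rb n ω) + rem n ω)) :
    HasBiasOrderTwo P T (m' / m) := by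
  have hi := h.estimates_left.inv hm hl hb
  have hρ := h.estimates_right.mul hi
  have h1 := h.meanBigO_ratio hm hi.lpBigO_zero
  -- The ratio times r_a - r_b estimates (m'/m)(c_a - c_b) with bias O(1/n), so after the factor κ/n
  -- only O(1/n²) is left besides the term that cancels the leading bias.
  have h2 := ((hρ.mul (hra.sub hrb)).bias.det_mul one_div_isBigO).const_mul κ
  have h3 := MeanBigO.of_lpBigO (j := 2) ((hρ.lpBigO_zero.mul hrem).mono (by norm_num))
  refine hasBiasOrderTwo_of_meanBigO (((h1.add h2).add h3).congr
    (fun n => (hT n).sub (AllLp.const _)) ?_)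
  filter_upwards [hTe] with n hn
  filter_upwards with ω
  rw [hn, hκ]
  ring

theorem IIDPair.secondOrder_meanHat {X Y : ℕ → Ω → ℝ} (h : IIDPair P X Y) :
    SecondOrder P (fun n ω => meanHat (sample X n ω)) (fun n ω => meanHat (sample Y n ω))
      (∫ ω, X 0 ω ∂P) (∫ ω, Y 0 ω ∂P)
      ((∫ ω, X 0 ω * X 0 ω ∂P) - (∫ ω, X 0 ω ∂P) * ∫ ω, X 0 ω ∂P)
      ((∫ ω, X 0 ω * Y 0 ω ∂P) - (∫ ω, X 0 ω ∂P) * ∫ ω, Y 0 ω ∂P) where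
  left := h.left.lpBigO_meanHat
  right := h.right.lpBigO_meanHat
  mean_left := h.left.meanBigO_meanHat 2
  mean_right := h.right.meanBigO_meanHat 2
  mean_sq := by simpa only [pow_two] using h.left.meanBigO_meanHat_sq
  mean_mul := h.meanBigO_meanHat_mul
  mean_cube := h.left.meanBigO_meanHat_cube
  mean_sq_mul := h.meanBigO_meanHat_sq_mul

namespace IIDMoments

variable {X : ℕ → Ω → ℝ}

/-- By `meanProdHat_eq` the tail is -v/(n(n - 1)) minus the error of the plug-in variance over n -
1. That error has rate n^(-1/2) but bias O(1/n), which explains the two different orders. -/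
theorem sqMeanTail_spec (h : IIDMoments P X) :
    LpBigO P 3 (sqMeanTail P X) ∧ MeanBigO P 2 (sqMeanTail P X) := by
  have hA (n : ℕ) : AllLp P (sqMeanTail P X n) := by
    have hc (c : ℝ) := AllLp.const (P := P) c
    have hd := (h.allLp_meanHat n).sub (hc (∫ ω, X 0 ω ∂P))
    exact (((h.allLp_meanPowHat 2 n).sub (hc _)).sub ((hc _).mul hd)).sub ((hd.pow 2).sub (hc _))
  have hp := h.pair_self.estimates_plugin_cov
  set v := (∫ ω, X 0 ω * X 0 ω ∂P) - (∫ ω, X 0 ω ∂P) * ∫ ω, X 0 ω ∂P with hv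
  have hv' : (∫ ω, X 0 ω ^ 2 ∂P) - (∫ ω, X 0 ω ∂P) ^ 2 = v := by simp only [hv, pow_two]
  have hj := LpBigO.const_det (P := P) one_div_sub_one_isBigO
  have hi := LpBigO.const_det (P := P) one_div_isBigO
  have hij := (hi.mul hj).const_mul (-v)
  have heq : ∀ᶠ n in atTop, sqMeanTail P X n =ᵐ[P] fun ω =>
      -v * (1 / (n : ℝ) * (1 / ((n : ℝ) - 1))) - 1 / ((n : ℝ) - 1) *
        (meanHat (fun i => sample X n ω i * sample X n ω i) -
          meanHat (sample X n ω) * meanHat (sample X n ω) - v) := by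
    filter_upwards [eventually_ge_atTop 2] with n hn
    filter_upwards with ω
    have h1 : (2 : ℝ) ≤ n := by exact_mod_cast hn
    have h2 : (n : ℝ) - 1 ≠ 0 := by linarith
    have h3 : (n : ℝ) ≠ 0 := by linarith
    rw [sqMeanTail, sqMeanRemainder, meanPowHat_two, meanProdHat_eq hn, hv']
    field_simp
    ring
  constructor
  · exact ((hij.mono (by norm_num)).sub (hj.mul hp.lpBigO)).congr hA heq
  · exact ((MeanBigO.of_lpBigO (j := 2) hij).sub
      (hp.bias.det_mul one_div_sub_one_isBigO)).congr hA heq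

theorem lpBigO_sqMeanRemainder (h : IIDMoments P X) : LpBigO P 2 (sqMeanRemainder P X) := by
  rw [sqMeanRemainder_eq]
  have hi := (LpBigO.const_det (P := P) one_div_isBigO).mul
    (LpBigO.const ((∫ ω, X 0 ω ^ 2 ∂P) - (∫ ω, X 0 ω ∂P) ^ 2))
  exact ((h.lpBigO_meanHat.pow 2).sub hi).add (h.sqMeanTail_spec.1.mono (by norm_num))

theorem meanBigO_sqMeanRemainder (h : IIDMoments P X) : MeanBigO P 2 (sqMeanRemainder P X) := by
  rw [sqMeanRemainder_eq]
  exact h.meanBigO_meanHat_sq.add h.sqMeanTail_spec.2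

end IIDMoments

namespace IIDPair

variable {X Y : ℕ → Ω → ℝ}

/-- The L^q orders multiply only to n^(-3/2). The gain comes from the mixed third moment and from
the unbiasedness of the mean; the tail is small enough in L^q. -/
theorem meanBigO_mul_sqMeanRemainder (h : IIDPair P X Y) :
    MeanBigO P 2 fun n ω =>
      (meanHat (sample X n ω) - ∫ ω, X 0 ω ∂P) * sqMeanRemainder P Y n ω := by
  have h1 := h.swap.meanBigO_meanHat_sq_mul
  have h2 := ((h.left.meanBigO_meanHat 1).det_mul one_div_isBigO).const_mul
    ((∫ ω, Y 0 ω ^ 2 ∂P) - (∫ ω, Y 0 ω ∂P) ^ 2)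
  have h3 := MeanBigO.of_lpBigO (j := 2) (h.left.lpBigO_meanHat.mul h.right.sqMeanTail_spec.1)
  convert (h1.sub h2).add h3 using 3 with n ω
  rw [sqMeanRemainder_eq]
  ring

/-- Each error is a linear part 2μ(mean - μ) plus a remainder of order 1/n in L^q; the factors 2μ
account for the 4 in the variance and covariance. In second moments the products of a linear part
and a remainder need `meanBigO_mul_sqMeanRemainder`; in third moments all terms with a remainder are
O(n^(-2)) in L^q. -/
theorem secondOrder_meanPowHat_two (h : IIDPair P X Y) :
    SecondOrder P (fun n ω => meanPowHat 2 (sample X n ω)) (fun n ω => meanPowHat 2 (sample Y n ω))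
      ((∫ ω, X 0 ω ∂P) ^ 2) ((∫ ω, Y 0 ω ∂P) ^ 2)
      (4 * (∫ ω, X 0 ω ∂P) ^ 2 *
        ((∫ ω, X 0 ω * X 0 ω ∂P) - (∫ ω, X 0 ω ∂P) * ∫ ω, X 0 ω ∂P))
      (4 * ((∫ ω, X 0 ω ∂P) * ∫ ω, Y 0 ω ∂P) *
        ((∫ ω, X 0 ω * Y 0 ω ∂P) - (∫ ω, X 0 ω ∂P) * ∫ ω, Y 0 ω ∂P)) := by
  have L := h.secondOrder_meanHat
  have hw := h.left.lpBigO_sqMeanRemainder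
  have hw' := h.right.lpBigO_sqMeanRemainder
  have hmw := h.left.meanBigO_sqMeanRemainder
  have hmw' := h.right.meanBigO_sqMeanRemainder
  have hDw := h.diag.meanBigO_mul_sqMeanRemainder
  have hDw' := h.meanBigO_mul_sqMeanRemainder
  have hEw := h.swap.meanBigO_mul_sqMeanRemainder
  have eX (n : ℕ) (ω : Ω) : meanPowHat 2 (sample X n ω) - (∫ ω, X 0 ω ∂P) ^ 2 =
      2 * (∫ ω, X 0 ω ∂P) * (meanHat (sample X n ω) - ∫ ω, X 0 ω ∂P) +
        sqMeanRemainder P X n ω := by rw [sqMeanRemainder]; ring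
  have eY (n : ℕ) (ω : Ω) : meanPowHat 2 (sample Y n ω) - (∫ ω, Y 0 ω ∂P) ^ 2 =
      2 * (∫ ω, Y 0 ω ∂P) * (meanHat (sample Y n ω) - ∫ ω, Y 0 ω ∂P) +
        sqMeanRemainder P Y n ω := by rw [sqMeanRemainder]; ring
  obtain ⟨hD, hE, hmD, hmE, hDD, hDE, hD3, hDDE⟩ := L
  set mx := ∫ ω, X 0 ω ∂P
  set my := ∫ ω, Y 0 ω ∂P
  set vx := (∫ ω, X 0 ω * X 0 ω ∂P) - mx * mx
  set c := (∫ ω, X 0 ω * Y 0 ω ∂P) - mx * my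
  set w := sqMeanRemainder P X
  set w' := sqMeanRemainder P Y
  constructor <;> simp only [eX, eY]
  · exact (hD.const_mul _).add (hw.mono (by norm_num))
  · exact (hE.const_mul _).add (hw'.mono (by norm_num))
  · exact (hmD.const_mul _).add hmw
  · exact (hmE.const_mul _).add hmw'
  · convert ((hDD.const_mul ((2 * mx) ^ 2)).add (hDw.const_mul (4 * mx))).add
      (MeanBigO.of_lpBigO (j := 2) (hw.pow 2)) using 3
    ring
  · convert (((hDE.const_mul (2 * mx * (2 * my))).add (hDw'.const_mul (2 * mx))).add
      (hEw.const_mul (2 * my))).add (MeanBigO.of_lpBigO (j := 2) (hw.mul hw')) using 3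
    ring
  · have r1 := ((hD.pow 2).mul hw).const_mul (3 * (2 * mx) ^ 2)
    have r2 := ((hD.mul (hw.pow 2)).mono (k := 4) (by norm_num)).const_mul (3 * (2 * mx))
    have r3 := (hw.pow 3).mono (k := 4) (by norm_num)
    convert (hD3.const_mul ((2 * mx) ^ 3)).add
      (MeanBigO.of_lpBigO (j := 2) ((r1.add r2).add r3)) using 3
    ring
  · have r1 := ((hD.pow 2).mul hw').const_mul ((2 * mx) ^ 2)
    have r2 := ((hD.mul hw).mul hE).const_mul (2 * (2 * mx) * (2 * my))
    have r3 := (((hD.mul hw).mul hw').mono (k := 4) (by norm_num)).const_mul (2 * (2 * mx))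
    have r4 := (((hw.pow 2).mul hE).mono (k := 4) (by norm_num)).const_mul (2 * my)
    have r5 := ((hw.pow 2).mul hw').mono (k := 4) (by norm_num)
    convert (hDDE.const_mul ((2 * mx) ^ 2 * (2 * my))).add
      (MeanBigO.of_lpBigO (j := 2) ((((r1.add r2).add r3).add r4).add r5)) using 3
    ring

end IIDPair

end Ratio

end Debias

/-! ### The corrected ratio of U-statistics as leading correction plus remainder. -/

namespace Debias

theorem ratioSqCorr_eq_zero {n : ℕ} (hn : n < 2) (x y : Fin n → ℝ) : ratioSqCorr x y = 0 := by
  have : meanPowHat 2 y = 0 := by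
    rw [meanPowHat, uStat, Nat.descFactorial_eq_zero_iff_lt.2 hn, Nat.cast_zero, div_zero]
  rw [ratioSqCorr, ratioSq, this, zero_div, zero_mul]

/-- With i = 1/n and j = 1/(n - 1), the fractions (n-2)/n, (n-3)/(n-1), (n-4)/n, (n-5)/(n-1) become
1-2i, 1-2j, 1-4i, 1-4j, so the coefficients are polynomials. With α = (1-2i)(1-2j) and β =
(1-4i)(1-4j), the coefficient of i(r_a* - r_b*) is 24 - 32α + 12αβ = 4 + 20(1 - α) - 12α(1 - β). Its
excess over 4 is O(1/n), and the other terms carry ij or j². -/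
theorem ratioSqCorr_eq {n : ℕ} (hn : 2 ≤ n) {i j : ℝ} (hi : i = 1 / (n : ℝ))
    (hj : j = 1 / ((n : ℝ) - 1)) (x y : Fin n → ℝ) :
    ratioSqCorr x y = meanPowHat 2 y * (meanPowHat 2 x)⁻¹ *
      (1 + 4 * i * (raStar x y - rbStar x) +
        (i * j * (12 - 48 * ((1 - 2 * i) * (1 - 2 * j)) +
            30 * ((1 - 2 * i) * (1 - 2 * j) * ((1 - 4 * i) * (1 - 4 * j)))) *
          (covSqHat x y * ((meanPowHat 2 x)⁻¹ * (meanPowHat 2 y)⁻¹) -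
            covSqHat x x * (meanPowHat 4 x)⁻¹) +
        i * (20 * (1 - (1 - 2 * i) * (1 - 2 * j)) -
            12 * ((1 - 2 * i) * (1 - 2 * j) * (1 - (1 - 4 * i) * (1 - 4 * j)))) *
          (raStar x y - rbStar x) +
        j ^ 2 * (24 * ((1 - 2 * i) * (1 - 2 * j) * (1 - 4 * i)) *
            (covHat (fun i => x i ^ 2) y * ((meanHat y)⁻¹ * (meanPowHat 2 x)⁻¹) +
              4 * (covHat x y * (covHat x x + meanPowHat 2 x) *
                ((meanHat y)⁻¹ * (meanPowHat 3 x)⁻¹)) -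
              (covHat (fun i => x i ^ 2) x * (meanPowHat 3 x)⁻¹ +
                4 * (covHat x x * (covHat x x + meanPowHat 2 x) * (meanPowHat 4 x)⁻¹))) -
          32 * (1 - 2 * i) *
            (covHat (fun i => x i ^ 2) y * ((meanHat y)⁻¹ * (meanPowHat 2 x)⁻¹) +
              2 * (covHat x y * (covHat x x + meanPowHat 2 x) *
                ((meanHat y)⁻¹ * (meanPowHat 3 x)⁻¹)) -
              (covHat (fun i => x i ^ 2) x * (meanPowHat 3 x)⁻¹ +
                2 * (covHat x x * (covHat x x + meanPowHat 2 x) * (meanPowHat 4 x)⁻¹)))))) := by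
  have h1 : (2 : ℝ) ≤ n := by exact_mod_cast hn
  have h2 : (n : ℝ) - 1 ≠ 0 := by linarith
  have h3 : (n : ℝ) ≠ 0 := by linarith
  have c1 (c : ℝ) : c / ((n : ℝ) * (n - 1)) = c * (i * j) := by rw [hi, hj]; field_simp
  have c2 (c : ℝ) : c / (n : ℝ) = c * i := by rw [hi]; field_simp
  have c3 : 32 * ((n : ℝ) - 2) / ((n : ℝ) * ((n : ℝ) - 1) ^ 2) = 32 * (1 - 2 * i) * j ^ 2 := by
    rw [hi, hj]; field_simp
  have c4 : 4 * ((n : ℝ) - 2) * ((n : ℝ) - 3) / ((n : ℝ) * ((n : ℝ) - 1)) =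
      4 * ((1 - 2 * i) * (1 - 2 * j)) := by
    rw [hi, hj]; field_simp; ring
  have c5 : 24 * ((n : ℝ) - 2) * ((n : ℝ) - 3) * ((n : ℝ) - 4) /
      ((n : ℝ) ^ 2 * ((n : ℝ) - 1) ^ 3) =
      24 * ((1 - 2 * i) * (1 - 2 * j) * (1 - 4 * i)) * j ^ 2 := by
    rw [hi, hj]; field_simp; ring
  have c6 : ((n : ℝ) - 2) * ((n : ℝ) - 3) * ((n : ℝ) - 4) * ((n : ℝ) - 5) /
      ((n : ℝ) ^ 2 * ((n : ℝ) - 1) ^ 2) =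
      (1 - 2 * i) * (1 - 2 * j) * ((1 - 4 * i) * (1 - 4 * j)) := by
    rw [hi, hj]; field_simp; ring
  simp only [ratioSqCorr, ratioSq, termA, termB, termC, termD, termE, termF, c3, c4, c5, c6]
  simp only [c1, c2]
  simp only [div_eq_mul_inv, mul_inv]
  ring

/-! ### Samples bounded away from zero: inverse moments and both bias estimates. -/

section Admissible

variable {Ω : Type*} [MeasurableSpace Ω] {P : Measure Ω} {X Y : ℕ → Ω → ℝ} {a : ℝ}

theorem hasBiasOrderTwo_of_ae_zero {T : ℕ → Ω → ℝ} (hT : ∀ n, T n =ᵐ[P] 0) :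
    HasBiasOrderTwo P T 0 := by
  refine ⟨fun n => (integrable_zero _ _ _).congr (hT n).symm, ?_⟩
  refine (isBigO_zero _ _).congr_left fun n => ?_
  rw [integral_congr_ae (hT n)]
  simp

/-- An i.i.d. sample of pairs with moments of all orders, in which the first component is bounded
below by `a > 0` and the second component vanishes or is at least `a`. -/
structure AdmissiblePair (P : Measure Ω) (X Y : ℕ → Ω → ℝ) (a : ℝ) : Prop
    extends IIDPair P X Y where
  pos : 0 < a
  left_ge : ∀ᵐ ω ∂P, a ≤ X 0 ω
  right_zero_or_ge : ∀ᵐ ω ∂P, Y 0 ω = 0 ∨ a ≤ Y 0 ω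

namespace AdmissiblePair

theorem ae_left_ge (h : AdmissiblePair P X Y a) : ∀ᵐ ω ∂P, ∀ i, a ≤ X i ω :=
  ae_all_iff.2 fun i => (h.left.ident i).symm.ae_snd measurableSet_Ici h.left_ge

theorem ae_right_zero_or_ge (h : AdmissiblePair P X Y a) :
    ∀ᵐ ω ∂P, ∀ i, Y i ω = 0 ∨ a ≤ Y i ω :=
  ae_all_iff.2 fun i => (h.right.ident i).symm.ae_snd
    ((measurableSet_singleton 0).union measurableSet_Ici) h.right_zero_or_ge

theorem zeroOrLarge_meanHat_left (h : AdmissiblePair P X Y a) :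
    ZeroOrLarge P 0 a fun n ω => meanHat (sample X n ω) := fun n => by
  filter_upwards [h.ae_left_ge] with ω hω
  rw [pow_zero, one_mul]
  exact meanHat_zero_or_le h.pos fun i : Fin n => hω i

theorem zeroOrLarge_meanHat_right (h : AdmissiblePair P X Y a) :
    ZeroOrLarge P 1 a fun n ω => meanHat (sample Y n ω) := fun n => by
  filter_upwards [h.ae_right_zero_or_ge] with ω hω
  exact meanHat_zero_or_large h.pos fun i : Fin n => hω i

theorem zeroOrLarge_meanPowHat_left (h : AdmissiblePair P X Y a) (m : ℕ) :
    ZeroOrLarge P 0 (a ^ m) fun n ω => meanPowHat m (sample X n ω) := fun n => by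
  filter_upwards [h.ae_left_ge] with ω hω
  rw [pow_zero, one_mul]
  exact uStat_zero_or_le (pow_pos h.pos m) fun e : Fin m → Fin n =>
    (prod_zero_or_large h.pos fun k => Or.inr (hω (e k))).resolve_left
      (Finset.prod_ne_zero_iff.2 fun k _ => (h.pos.trans_le (hω (e k))).ne')

theorem zeroOrLarge_meanPowHat_right (h : AdmissiblePair P X Y a) (m : ℕ) :
    ZeroOrLarge P m (a ^ m) fun n ω => meanPowHat m (sample Y n ω) := fun n => by
  filter_upwards [h.ae_right_zero_or_ge] with ω hω
  exact uStat_zero_or_large (pow_pos h.pos m) fun e : Fin m → Fin n =>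
    prod_zero_or_large h.pos fun k => hω (e k)

theorem zeroOrLarge_meanProdHat (h : AdmissiblePair P X Y a) :
    ZeroOrLarge P 2 (a * a) fun n ω => meanProdHat (sample X n ω) (sample Y n ω) := fun n => by
  filter_upwards [h.ae_left_ge, h.ae_right_zero_or_ge] with ω hω hω'
  refine uStat_zero_or_large (mul_pos h.pos h.pos) fun e : Fin 2 → Fin n => ?_
  rcases hω' (e 1) with h0 | h0
  · exact Or.inl (by simp [sample, h0])
  · exact Or.inr (mul_le_mul (hω _) h0 h.pos.le (h.pos.le.trans (hω _)))

/-- A nonnegative variable with mean zero vanishes. This settles the degenerate case, in which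
inverses of Y-statistics are not controlled. -/
theorem ae_right_eq_zero (h : AdmissiblePair P X Y a) (h0 : ∫ ω, Y 0 ω ∂P = 0) :
    ∀ᵐ ω ∂P, ∀ i, Y i ω = 0 := by
  have hnn : 0 ≤ᵐ[P] Y 0 := by
    filter_upwards [h.right_zero_or_ge] with ω hω
    rcases hω with hω | hω
    · exact hω.ge
    · exact h.pos.le.trans hω
  have h1 := (integral_eq_zero_iff_of_nonneg_ae hnn h.allLp_right.integrable).1 h0
  exact ae_all_iff.2 fun i =>
    (h.right.ident i).symm.ae_snd (measurableSet_singleton (0 : ℝ)) h1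

variable [IsProbabilityMeasure P]

theorem mean_left_pos (h : AdmissiblePair P X Y a) : 0 < ∫ ω, X 0 ω ∂P := by
  have := integral_mono_ae (integrable_const a) h.allLp_left.integrable h.left_ge
  simp only [integral_const, probReal_univ, smul_eq_mul, one_mul] at this
  exact h.pos.trans_le this

theorem lpBigO_inv_meanHat_left (h : AdmissiblePair P X Y a) :
    LpBigO P 0 fun n ω => (meanHat (sample X n ω))⁻¹ :=
  .inv_of_large h.zeroOrLarge_meanHat_left h.pos
    fun n => (h.left.allLp_meanHat n).aestronglyMeasurable

theorem lpBigO_inv_meanHat_right (h : AdmissiblePair P X Y a) (hy : ∫ ω, Y 0 ω ∂P ≠ 0) :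
    LpBigO P 0 fun n ω => (meanHat (sample Y n ω))⁻¹ :=
  h.right.estimates_meanHat.lpBigO_inv hy h.zeroOrLarge_meanHat_right h.pos

theorem lpBigO_inv_meanPowHat_left (h : AdmissiblePair P X Y a) (m : ℕ) :
    LpBigO P 0 fun n ω => (meanPowHat m (sample X n ω))⁻¹ :=
  .inv_of_large (h.zeroOrLarge_meanPowHat_left m) (pow_pos h.pos m)
    fun n => (h.left.allLp_meanPowHat m n).aestronglyMeasurable

theorem lpBigO_inv_meanPowHat_two_right (h : AdmissiblePair P X Y a)
    (hy : ∫ ω, Y 0 ω ∂P ≠ 0) : LpBigO P 0 fun n ω => (meanPowHat 2 (sample Y n ω))⁻¹ :=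
  h.toIIDPair.secondOrder_meanPowHat_two.estimates_right.lpBigO_inv (pow_ne_zero 2 hy)
    (h.zeroOrLarge_meanPowHat_right 2) (pow_pos h.pos 2)

theorem estimates_inv_meanPowHat_two_left (h : AdmissiblePair P X Y a) :
    Estimates P (fun n ω => (meanPowHat 2 (sample X n ω))⁻¹) ((∫ ω, X 0 ω ∂P) ^ 2)⁻¹ :=
  h.toIIDPair.secondOrder_meanPowHat_two.estimates_left.inv (pow_pos h.mean_left_pos 2).ne'
    (h.zeroOrLarge_meanPowHat_left 2) (pow_pos h.pos 2)

theorem estimates_inv_meanProdHat (h : AdmissiblePair P X Y a) (hy : ∫ ω, Y 0 ω ∂P ≠ 0) :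
    Estimates P (fun n ω => (meanProdHat (sample X n ω) (sample Y n ω))⁻¹)
      ((∫ ω, X 0 ω ∂P) * ∫ ω, Y 0 ω ∂P)⁻¹ :=
  h.toIIDPair.estimates_meanProdHat.inv (mul_ne_zero h.mean_left_pos.ne' hy)
    h.zeroOrLarge_meanProdHat (mul_pos h.pos h.pos)

end AdmissiblePair

variable [IsProbabilityMeasure P]

/-- The product is 0 or 1. It controls the quotients by a sample covariance, which may be
arbitrarily small. -/
theorem lpBigO_mul_inv_self {c : ℕ → Ω → ℝ} (hc : ∀ n, AEStronglyMeasurable (c n) P) :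
    LpBigO P 0 fun n ω => c n ω * (c n ω)⁻¹ := by
  refine (LpBigO.const 1).of_le
    (fun n => (hc n).mul (hc n).aemeasurable.inv.aestronglyMeasurable) fun n => ?_
  filter_upwards with ω
  by_cases h : c n ω = 0
  · simp [h]
  · simp [h]

theorem IIDPair.lpBigO_covHat_sq (h : IIDPair P X Y) :
    LpBigO P 0 fun n ω => covHat (fun i => sample X n ω i ^ 2) (sample Y n ω) :=
  (h.map (φ := fun p => p.1 ^ 2) (ψ := fun p => p.2) (by fun_prop) (by fun_prop)
    (h.allLp_left.pow 2) h.allLp_right).estimates_covHat.lpBigO_zero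

namespace AdmissiblePair

theorem estimates_raStar (h : AdmissiblePair P X Y a) (hy : ∫ ω, Y 0 ω ∂P ≠ 0) :
    Estimates P (fun n ω => raStar (sample X n ω) (sample Y n ω))
      (((∫ ω, X 0 ω * Y 0 ω ∂P) - (∫ ω, X 0 ω ∂P) * ∫ ω, Y 0 ω ∂P) *
        ((∫ ω, X 0 ω ∂P) * ∫ ω, Y 0 ω ∂P)⁻¹) := by
  have hp := h.toIIDPair
  have hmain := hp.estimates_covHat.mul (h.estimates_inv_meanProdHat hy)
  have hc := hp.estimates_covHat.lpBigO_zero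
  have hx := hp.left.estimates_meanHat.lpBigO_zero
  have hy' := hp.right.estimates_meanHat.lpBigO_zero
  have hxi := h.lpBigO_inv_meanHat_left
  have hyi := h.lpBigO_inv_meanHat_right hy
  have hxy := hxi.mul hyi
  have r1 := hmain.lpBigO_zero.mul (((LpBigO.const (-4)).sub
    ((hp.diag.estimates_covHat.lpBigO_zero.mul (h.lpBigO_inv_meanPowHat_left 2)).add
      (hp.swap.diag.estimates_covHat.lpBigO_zero.mul (h.lpBigO_inv_meanPowHat_two_right hy)))).sub
    ((hc.mul hxy).const_mul 2))
  -- The prefactor's covariance meets the covariance in the inner denominator; the product c c⁻¹ is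
  -- kept as it is, because c may vanish.
  have r2 := (lpBigO_mul_inv_self hc.aestronglyMeasurable).mul
    ((h.estimates_inv_meanProdHat hy).lpBigO_zero.mul
      (((hy'.mul hp.lpBigO_covHat_sq).add (hx.mul hp.swap.lpBigO_covHat_sq)).mul hxy))
  convert hmain.add_lpBigO
    ((LpBigO.const_det one_div_sub_one_isBigO).mul (r1.add r2)) using 3 with n ω
  simp only [raStar, div_eq_mul_inv, mul_inv]
  ring

theorem estimates_rbStar (h : AdmissiblePair P X Y a) :
    Estimates P (fun n ω => rbStar (sample X n ω))
      (((∫ ω, X 0 ω * X 0 ω ∂P) - (∫ ω, X 0 ω ∂P) * ∫ ω, X 0 ω ∂P) *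
        ((∫ ω, X 0 ω ∂P) ^ 2)⁻¹) := by
  have hp := h.toIIDPair.diag
  have hmain := hp.estimates_covHat.mul h.estimates_inv_meanPowHat_two_left
  have hc := hp.estimates_covHat.lpBigO_zero
  have hi := h.lpBigO_inv_meanPowHat_left 2
  have r1 := hmain.lpBigO_zero.mul ((LpBigO.const (-4)).sub ((hc.mul hi).const_mul 4))
  have r2 := ((lpBigO_mul_inv_self hc.aestronglyMeasurable).mul
    (hi.mul (hp.lpBigO_covHat_sq.mul h.lpBigO_inv_meanHat_left))).const_mul 2
  convert hmain.add_lpBigO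
    ((LpBigO.const_det one_div_sub_one_isBigO).mul (r1.add r2)) using 3 with n ω
  simp only [rbStar, div_eq_mul_inv, mul_inv]
  ring

end AdmissiblePair

namespace AdmissiblePair

theorem hasBiasOrderTwo_ratioMeanCorr (h : AdmissiblePair P X Y a) :
    HasBiasOrderTwo P (fun n ω => ratioMeanCorr (sample X n ω) (sample Y n ω))
      ((∫ ω, Y 0 ω ∂P) / ∫ ω, X 0 ω ∂P) := by
  by_cases hy : ∫ ω, Y 0 ω ∂P = 0
  · rw [hy, zero_div]
    refine hasBiasOrderTwo_of_ae_zero fun n => ?_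
    filter_upwards [h.ae_right_eq_zero hy] with ω hω
    have : meanHat (sample Y n ω) = 0 := by simp [meanHat, sample, hω]
    simp [ratioMeanCorr, ratioMean, this]
  have hp := h.toIIDPair
  have hx0 := h.mean_left_pos.ne'
  have hra := h.estimates_raStar hy
  have hrb := h.estimates_rbStar
  have hc := hp.estimates_covHat.lpBigO_zero
  have hv := hp.diag.estimates_covHat.lpBigO_zero
  have hx := hp.left.estimates_meanHat.lpBigO_zero
  have hyi := h.lpBigO_inv_meanHat_right hy
  have h2 := h.lpBigO_inv_meanPowHat_left 2
  have h3 := h.lpBigO_inv_meanPowHat_left 3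
  have h4 := h.lpBigO_inv_meanPowHat_left 4
  have hi := LpBigO.const_det (P := P) one_div_isBigO
  -- The bracket with the explicit factor 1/n² needs only bounded moments; its exact form has no
  -- effect at this order.
  have hrem := ((hi.pow 2).mul (((((hp.lpBigO_covHat_sq.sub ((hx.mul hc).const_mul 2)).mul
    (h2.mul hyi)).sub ((hp.diag.lpBigO_covHat_sq.sub ((hx.mul hv).const_mul 2)).mul h3)).sub
    (((hv.mul hc).mul (h3.mul hyi)).const_mul 3)).add
    (((hv.pow 2).mul h4).const_mul 3))).neg
  obtain ⟨rem, hrem4, heq⟩ : ∃ rem, LpBigO P 4 rem ∧ ∀ n ω,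
      ratioMeanCorr (sample X n ω) (sample Y n ω) =
        meanHat (sample Y n ω) * (meanHat (sample X n ω))⁻¹ *
          (1 + 1 * (1 / (n : ℝ)) * (raStar (sample X n ω) (sample Y n ω) -
            rbStar (sample X n ω)) + rem n ω) := by
    refine ⟨_, hrem, fun n ω => ?_⟩
    simp only [ratioMeanCorr, ratioMean, div_eq_mul_inv, mul_inv]
    ring
  refine hp.secondOrder_meanHat.hasBiasOrderTwo hx0 h.zeroOrLarge_meanHat_left h.pos hra hrb
    hrem4 (κ := 1) ?_ (fun n => ?_) (Eventually.of_forall heq)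
  · field_simp
  · simp only [heq]
    exact ((hp.right.allLp_meanHat n).mul (h.lpBigO_inv_meanHat_left.allLp n)).mul
      (((AllLp.const 1).add ((AllLp.const _).mul ((hra.allLp n).sub (hrb.allLp n)))).add
        (hrem4.allLp n))

theorem hasBiasOrderTwo_ratioSqCorr (h : AdmissiblePair P X Y a) :
    HasBiasOrderTwo P (fun n ω => ratioSqCorr (sample X n ω) (sample Y n ω))
      ((∫ ω, Y 0 ω ∂P) ^ 2 / (∫ ω, X 0 ω ∂P) ^ 2) := by
  by_cases hy : ∫ ω, Y 0 ω ∂P = 0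
  · rw [hy, zero_pow two_ne_zero, zero_div]
    refine hasBiasOrderTwo_of_ae_zero fun n => ?_
    filter_upwards [h.ae_right_eq_zero hy] with ω hω
    have : meanPowHat 2 (sample Y n ω) = 0 := by simp [meanPowHat, uStat, sample, hω]
    simp [ratioSqCorr, ratioSq, this]
  have hp := h.toIIDPair
  have hx0 := h.mean_left_pos.ne'
  have hra := h.estimates_raStar hy
  have hrb := h.estimates_rbStar
  have hrr := (hra.sub hrb).lpBigO_zero
  have hc := hp.estimates_covHat.lpBigO_zero
  have hv := hp.diag.estimates_covHat.lpBigO_zero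
  have hyi := h.lpBigO_inv_meanHat_right hy
  have h2 := h.lpBigO_inv_meanPowHat_left 2
  have h3 := h.lpBigO_inv_meanPowHat_left 3
  have h4 := h.lpBigO_inv_meanPowHat_left 4
  have hvm := hv.add hp.secondOrder_meanPowHat_two.estimates_left.lpBigO_zero
  have hi := LpBigO.const_det (P := P) one_div_isBigO
  have hj := LpBigO.const_det (P := P) one_div_sub_one_isBigO
  have hi0 := hi.mono (Nat.zero_le _)
  have hj0 := hj.mono (Nat.zero_le _)
  have hone := LpBigO.const (P := P) 1
  have hi2 := hone.sub (hi0.const_mul 2)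
  have hi4 := hone.sub (hi0.const_mul 4)
  have hα := hi2.mul (hone.sub (hj0.const_mul 2))
  have hβ := hi4.mul (hone.sub (hj0.const_mul 4))
  -- 1 - (1-2i)(1-2j) = 2i + 2j(1-2i): the deviation from 1 is O(1/n), so multiplied by a further
  -- 1/n it belongs to the remainder.
  have hα1 : LpBigO P 2 fun n _ =>
      1 - (1 - 2 * (1 / (n : ℝ))) * (1 - 2 * (1 / ((n : ℝ) - 1))) := by
    convert (hi.const_mul 2).add ((hj.const_mul 2).mul hi2) using 3
    ring
  have hβ1 : LpBigO P 2 fun n _ =>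
      1 - (1 - 4 * (1 / (n : ℝ))) * (1 - 4 * (1 / ((n : ℝ) - 1))) := by
    convert (hi.const_mul 4).add ((hj.const_mul 4).mul hi4) using 3
    ring
  have hc2 := hp.lpBigO_covHat_sq.mul (hyi.mul h2)
  have hv2 := hp.diag.lpBigO_covHat_sq.mul h3
  have hcv := (hc.mul hvm).mul (hyi.mul h3)
  have hvv := (hv.mul hvm).mul h4
  have hG (c : ℝ) := (hc2.add (hcv.const_mul c)).sub (hv2.add (hvv.const_mul c))
  have hQ := (hp.lpBigO_covSqHat.mul (h2.mul (h.lpBigO_inv_meanPowHat_two_right hy))).sub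
    (hp.diag.lpBigO_covSqHat.mul h4)
  have r1 := ((hi.mul hj).mul (((LpBigO.const 12).sub (hα.const_mul 48)).add
    ((hα.mul hβ).const_mul 30))).mul hQ
  have r2 := (hi.mul ((hα1.const_mul 20).sub (((hα.mul hβ1).mono (by norm_num)).const_mul 12))).mul
    hrr
  have r3 := (hj.pow 2).mul ((((hα.mul hi4).const_mul 24).mul (hG 4)).sub
    ((hi2.const_mul 32).mul (hG 2)))
  obtain ⟨rem, hrem, heq⟩ : ∃ rem, LpBigO P 4 rem ∧ ∀ n : ℕ, 2 ≤ n → ∀ ω,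
      ratioSqCorr (sample X n ω) (sample Y n ω) =
        meanPowHat 2 (sample Y n ω) * (meanPowHat 2 (sample X n ω))⁻¹ *
          (1 + 4 * (1 / (n : ℝ)) * (raStar (sample X n ω) (sample Y n ω) -
            rbStar (sample X n ω)) + rem n ω) :=
    ⟨_, (r1.add r2).add r3, fun n hn ω => ratioSqCorr_eq hn rfl rfl _ _⟩
  -- Here κ = 4 because both the variance and the covariance of the U-statistics carry the factor 4
  -- of their linear parts.
  refine hp.secondOrder_meanPowHat_two.hasBiasOrderTwo (pow_ne_zero 2 hx0)
    (h.zeroOrLarge_meanPowHat_left 2) (pow_pos h.pos 2) hra hrb hrem (κ := 4)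
    ?_ (fun n => ?_) ((eventually_ge_atTop 2).mono heq)
  · field_simp
  · rcases lt_or_ge n 2 with hn | hn
    · simpa only [ratioSqCorr_eq_zero hn] using AllLp.const 0
    · simp only [heq n hn]
      exact ((hp.right.allLp_meanPowHat 2 n).mul (h2.allLp n)).mul
        (((AllLp.const 1).add ((AllLp.const _).mul ((hra.allLp n).sub (hrb.allLp n)))).add
          (hrem.allLp n))

end AdmissiblePair

end Admissible

end Debias

namespace Debias

/-! ### The Dirichlet kernel on the simplex. -/

section Dirichlet

variable {K : ℕ} {h : ℝ} {z : Fin K → ℝ}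

theorem dirichletKernel_pos (hh : 0 < h) (hz : ∀ k, 0 < z k) {s : Fin K → ℝ}
    (hs : s ∈ stdSimplex ℝ (Fin K)) : 0 < dirichletKernel h z s := by
  have hpos (k : Fin K) : 0 < s k / h + 1 := by
    have := div_nonneg (hs.1 k) hh.le
    linarith
  -- The coordinates sum to 1, so K > 0 and the argument of the Gamma function in the numerator is
  -- positive.
  have hne : (Finset.univ : Finset (Fin K)).Nonempty := by
    by_contra h0
    have h1 := hs.2
    rw [Finset.not_nonempty_iff_eq_empty.1 h0, Finset.sum_empty] at h1
    exact zero_ne_one h1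
  refine mul_pos (div_pos (Real.Gamma_pos_of_pos (Finset.sum_pos (fun k _ => hpos k) hne)) ?_) ?_
  · exact Finset.prod_pos fun k _ => Real.Gamma_pos_of_pos (hpos k)
  · exact Finset.prod_pos fun k _ => Real.rpow_pos_of_pos (hz k) _

theorem continuousOn_dirichletKernel (hh : 0 < h) (hz : ∀ k, 0 < z k) :
    ContinuousOn (dirichletKernel h z) (stdSimplex ℝ (Fin K)) := by
  intro s hs
  have hpos (k : Fin K) : 0 < s k / h + 1 := by
    have := div_nonneg (hs.1 k) hh.le
    linarith
  have hne : (Finset.univ : Finset (Fin K)).Nonempty := by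
    by_contra h0
    have h1 := hs.2
    rw [Finset.not_nonempty_iff_eq_empty.1 h0, Finset.sum_empty] at h1
    exact zero_ne_one h1
  have hΓ {t : ℝ} (ht : 0 < t) : ContinuousAt Real.Gamma t :=
    (Real.differentiableAt_Gamma fun m => by
      have : (0 : ℝ) ≤ m := Nat.cast_nonneg m
      linarith).continuousAt
  have hk (k : Fin K) : ContinuousAt (fun s : Fin K → ℝ => s k / h + 1) s :=
    (((continuous_apply k).tendsto s).div_const h).add_const 1
  refine ContinuousAt.continuousWithinAt (ContinuousAt.mul (ContinuousAt.div ?_ ?_ ?_) ?_)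
  · exact ContinuousAt.comp (f := fun s : Fin K → ℝ => ∑ k, (s k / h + 1))
      (hΓ (Finset.sum_pos (fun k _ => hpos k) hne)) (tendsto_finsetSum _ fun k _ => hk k)
  · exact tendsto_finsetProd _ fun k _ =>
      ContinuousAt.comp (f := fun s : Fin K → ℝ => s k / h + 1) (hΓ (hpos k)) (hk k)
  · exact (Finset.prod_pos fun k _ => Real.Gamma_pos_of_pos (hpos k)).ne'
  · exact tendsto_finsetProd _ fun k _ =>
      ContinuousAt.rpow continuousAt_const ((hk k).sub continuousAt_const) (Or.inl (hz k).ne')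

variable {Ω E : Type*} [MeasurableSpace Ω] [MeasurableSpace E] {P : Measure Ω}
  [IsProbabilityMeasure P]

theorem admissiblePair_weight_label {g : E → ℝ} {x : ℕ → Ω → E} {y : ℕ → Ω → Fin K} {a b : ℝ}
    (c : Fin K) (hg : Measurable g) (ha : 0 < a) (hag : ∀ v, a ≤ g v) (hgb : ∀ v, g v ≤ b)
    (hxy : IsIID P fun i ω => (x i ω, y i ω)) :
    AdmissiblePair P (fun i ω => g (x i ω)) (fun i ω => g (x i ω) * (if y i ω = c then 1 else 0))
      a := by
  have hφ : Measurable fun p : E × Fin K => g p.1 * (if p.2 = c then 1 else 0) :=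
    (hg.comp measurable_fst).mul
      (Measurable.ite (measurable_snd (measurableSet_singleton c)) measurable_const
        measurable_const)
  have hxy0 : AEMeasurable (fun ω => (x 0 ω, y 0 ω)) P := (hxy.2 0).aemeasurable_fst
  have hb (v : E) : ‖g v‖ ≤ b := by
    rw [Real.norm_of_nonneg (ha.le.trans (hag v))]
    exact hgb v
  refine ⟨⟨⟨?_, fun i => ?_⟩, fun q => ?_, fun q => ?_⟩, ha, Eventually.of_forall fun ω => hag _,
    Eventually.of_forall fun ω => ?_⟩
  · exact hxy.1.comp (fun _ p => (g p.1, g p.1 * (if p.2 = c then 1 else 0)))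
      fun _ => (hg.comp measurable_fst).prodMk hφ
  · exact (hxy.2 i).comp ((hg.comp measurable_fst).prodMk hφ)
  · exact MemLp.of_bound ((hg.comp measurable_fst).comp_aemeasurable hxy0).aestronglyMeasurable
      _ (Eventually.of_forall fun ω => hb _)
  · refine MemLp.of_bound (hφ.comp_aemeasurable hxy0).aestronglyMeasurable b
      (Eventually.of_forall fun ω => ?_)
    refine le_trans ?_ (hb (x 0 ω))
    rw [norm_mul]
    refine mul_le_of_le_one_right (norm_nonneg _) ?_
    split_ifs <;> simp
  · by_cases hc : y 0 ω = c
    · right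
      simpa only [hc, if_true, mul_one] using hag _
    · left
      simp [hc]

/-- Compactness of the simplex gives the kernel a positive minimum, which serves as `a`, and a
finite maximum, which yields all moments. -/
theorem admissiblePair_kernel {k : (Fin K → ℝ) → (Fin K → ℝ) → ℝ} {f : E → Fin K → ℝ}
    {x : ℕ → Ω → E} {y : ℕ → Ω → Fin K} (c : Fin K)
    (hcont : ContinuousOn (k z) (stdSimplex ℝ (Fin K)))
    (hpos : ∀ s ∈ stdSimplex ℝ (Fin K), 0 < k z s)
    (hf : Measurable f) (hfs : ∀ v, f v ∈ stdSimplex ℝ (Fin K))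
    (hxy : IsIID P fun i ω => (x i ω, y i ω)) (hzs : z ∈ stdSimplex ℝ (Fin K)) :
    ∃ a, AdmissiblePair P (kernelWeight k z f x) (kernelLabel k z f x y c) a := by
  have hcomp := isCompact_stdSimplex ℝ (Fin K)
  obtain ⟨s₀, hs₀, hmin⟩ := hcomp.exists_isMinOn ⟨z, hzs⟩ hcont
  obtain ⟨s₁, hs₁, hmax⟩ := hcomp.exists_isMaxOn ⟨z, hzs⟩ hcont
  -- Continuity is known only on the simplex, so measurability is obtained by factoring `f` through
  -- the subtype.
  have hg : Measurable fun v => k z (f v) :=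
    (continuousOn_iff_continuous_domRestrict.1 hcont).measurable.comp (hf.subtype_mk (h := hfs))
  exact ⟨k z s₀, admissiblePair_weight_label (g := fun v => k z (f v)) c hg (hpos s₀ hs₀)
    (fun v => hmin (hfs v)) (fun v => hmax (hfs v)) hxy⟩

end Dirichlet

end Debias

theorem proposition3 {Ω : Type*} [MeasurableSpace Ω] (P : MeasureTheory.Measure Ω)
    [MeasureTheory.IsProbabilityMeasure P] :
    -- both schemes, for a general i.i.d. sample of pairs
    (∀ (X Y : ℕ → Ω → ℝ) (a : ℝ), 0 < a →
      Debias.IsIID P (fun i ω => (X i ω, Y i ω)) →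
      (∀ q : ℕ, MeasureTheory.MemLp (X 0) q P) →
      (∀ q : ℕ, MeasureTheory.MemLp (Y 0) q P) →
      (∀ᵐ ω ∂P, a ≤ X 0 ω) →
      (∀ᵐ ω ∂P, Y 0 ω = 0 ∨ a ≤ Y 0 ω) →
      Debias.HasBiasOrderTwo P
          (fun n ω => Debias.ratioMeanCorr (Debias.sample X n ω) (Debias.sample Y n ω))
          ((∫ ω, Y 0 ω ∂P) / ∫ ω, X 0 ω ∂P) ∧
        Debias.HasBiasOrderTwo P
          (fun n ω => Debias.ratioSqCorr (Debias.sample X n ω) (Debias.sample Y n ω))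
          ((∫ ω, Y 0 ω ∂P) ^ 2 / (∫ ω, X 0 ω ∂P) ^ 2)) ∧
    -- both schemes, for the Dirichlet kernel estimators at an interior point of the simplex
    (∀ (d K : ℕ) (f : EuclideanSpace ℝ (Fin d) → Fin K → ℝ)
      (x : ℕ → Ω → EuclideanSpace ℝ (Fin d)) (y : ℕ → Ω → Fin K)
      (h : ℝ) (z : Fin K → ℝ) (c : Fin K), 0 < h →
      Measurable f → (∀ v, f v ∈ stdSimplex ℝ (Fin K)) →
      Debias.IsIID P (fun i ω => (x i ω, y i ω)) →
      z ∈ stdSimplex ℝ (Fin K) → (∀ k, 0 < z k) →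
      Debias.HasBiasOrderTwo P
          (fun n ω => Debias.ratioMeanCorr
            (Debias.sample (Debias.kernelWeight (Debias.dirichletKernel h) z f x) n ω)
            (Debias.sample (Debias.kernelLabel (Debias.dirichletKernel h) z f x y c) n ω))
          ((∫ ω, Debias.kernelLabel (Debias.dirichletKernel h) z f x y c 0 ω ∂P) /
            ∫ ω, Debias.kernelWeight (Debias.dirichletKernel h) z f x 0 ω ∂P) ∧
        Debias.HasBiasOrderTwo P
          (fun n ω => Debias.ratioSqCorr
            (Debias.sample (Debias.kernelWeight (Debias.dirichletKernel h) z f x) n ω)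
            (Debias.sample (Debias.kernelLabel (Debias.dirichletKernel h) z f x y c) n ω))
          ((∫ ω, Debias.kernelLabel (Debias.dirichletKernel h) z f x y c 0 ω ∂P) ^ 2 /
            (∫ ω, Debias.kernelWeight (Debias.dirichletKernel h) z f x 0 ω ∂P) ^ 2)) := by
  constructor
  · intro X Y a ha hiid hX hY hXa hYa
    have hp : Debias.AdmissiblePair P X Y a := ⟨⟨hiid, hX, hY⟩, ha, hXa, hYa⟩
    exact ⟨hp.hasBiasOrderTwo_ratioMeanCorr, hp.hasBiasOrderTwo_ratioSqCorr⟩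
  · intro d K f x y h z c hh hf hfs hiid hzs hz
    obtain ⟨a, hp⟩ := Debias.admissiblePair_kernel c
      (Debias.continuousOn_dirichletKernel hh hz)
      (fun _ => Debias.dirichletKernel_pos hh hz) hf hfs hiid hzs
    exact ⟨hp.hasBiasOrderTwo_ratioMeanCorr, hp.hasBiasOrderTwo_ratioSqCorr⟩
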